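/- Let $K$ be an infinite field of characteristic $p>0$, let $n\ge r$ be positive integers, let $S=S_K(n,r)=\operatorname{End}_{\mathfrak S_r}(V^{\otimes r})$, $V=K^n$, be the Schur algebra, and let $\lambda=(\lambda_1\ge\dots\ge\lambda_m)$ with $m\ge 2$, $\lambda_m>0$, and $\mu=(\mu_1\ge\mu_2)$ with $\mu_2\ge 0$ be partitions of $r$ such that $\mu_2\le\lambda_1\le\mu_1$. Write $D_aV$ for the divided powers of $V$, $D(\lambda)=D_{\lambda_1}V\otimes\dots\otimes D_{\lambda_m}V$, and $\Delta(\lambda)$ for the Weyl module, i.e. the image of the map $d'_\lambda:D(\lambda)\to\Lambda(\lambda^t)=\Lambda^{\lambda^t_1}V\otimes\Lambda^{\lambda^t_2}V\otimes\cdots$ that diagonalizes each $D_{\lambda_i}V$ into $V^{\otimes\lambda_i}$ (one factor for each box of row $i$ of the diagram of $\lambda$) and then multiplies the factors in each column in the exterior algebra; likewise for $\mu$. Let $\mathrm{ST}_\lambda(\mu)$ be the set of standard tableaux of shape $\mu$ and weight $\lambda$: fillings of the diagram of $\mu$ in which each $s\in\{1,\dots,m\}$ occurs $\lambda_s$ times,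 with rows weakly increasing and columns strictly increasing. For $T\in\mathrm{ST}_\lambda(\mu)$ with $a_s$ (resp. $b_s$) entries $s$ in the first (resp. second) row, let $$\phi_T:D(\lambda)\to\Delta(\mu),\qquad x_1\otimes\dots\otimes x_m\mapsto\sum d'_\mu\bigl(x_1(a_1)\cdots x_m(a_m)\otimes x_1(b_1)'\cdots x_m(b_m)'\bigr),$$ where $\sum x_s(a_s)\otimes x_s(b_s)'$ is the image of $x_s$ under the component $D_{\lambda_s}V\to D_{a_s}V\otimes D_{b_s}V$ of the comultiplication of the divided power algebra. For positive integers $x,y$ let $R(x,y)=\gcd\{\binom{x}{1},\binom{x+1}{2},\dots,\binom{x+y-1}{y}\}$, and let $R(x,0)=0$. If $p$ divides $R(\lambda_1-\mu_2+1,\min\{\lambda_2,\mu_1-\lambda_1\})$ and $R(\lambda_i+1,\lambda_{i+1})$ for $i=2,\dots,m-1$, then the map $\psi=\sum_{T\in\mathrm{ST}_\lambda(\mu)}\phi_T:D(\lambda)\to\Delta(\mu)$ induces a nonzero homomorphism of $S$-modules $\bar\psi:\Delta(\lambda)\to\Delta(\mu)$; that is, there is a nonzero $S$-homomorphism $\bar\psi$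 with $\bar\psi\circ d'_\lambda=\psi$. -/

import Mathlib

open scoped TensorProduct

namespace WeylHom

noncomputable section

/-! ## Tensor space and the Schur algebra -/

/-- The tensor space `V^{⊗ r}` of the natural module `V = K^n`. -/
def Tensors (K : Type*) [Field K] (n r : ℕ) : Type _ :=
  ⨂[K] (_ : Fin r), (Fin n → K)

instance instAddCommGroupTensors (K : Type*) [Field K] (n r : ℕ) :
    AddCommGroup (Tensors K n r) :=
  inferInstanceAs (AddCommGroup (⨂[K] (_ : Fin r), (Fin n → K)))

instance instModuleTensors (K : Type*) [Field K] (n r : ℕ) : Module K (Tensors K n r) :=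
  inferInstanceAs (Module K (⨂[K] (_ : Fin r), (Fin n → K)))

/-- The identity map, passing between `Tensors` and its definition. -/
def tensorsEquiv (K : Type*) [Field K] (n r : ℕ) :
    (⨂[K] (_ : Fin r), (Fin n → K)) ≃ₗ[K] Tensors K n r where
  toFun x := x
  invFun x := x
  map_add' _ _ := rfl
  map_smul' _ _ := rfl

/-- Pure tensors `v₁ ⊗ ⋯ ⊗ v_r`. -/
def tmul (K : Type*) [Field K] (n r : ℕ) :
    MultilinearMap K (fun _ : Fin r => (Fin n → K)) (Tensors K n r) :=
  (tensorsEquiv K n r).toLinearMap.compMultilinearMap (PiTensorProduct.tprod K)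

theorem tensors_hom_ext {K : Type*} [Field K] {n r : ℕ} {M : Type*} [AddCommGroup M] [Module K M]
    {f g : Tensors K n r →ₗ[K] M} (h : ∀ v, f (tmul K n r v) = g (tmul K n r v)) : f = g := by
  have h1 : f ∘ₗ (tensorsEquiv K n r).toLinearMap = g ∘ₗ (tensorsEquiv K n r).toLinearMap := by
    apply PiTensorProduct.ext
    exact MultilinearMap.ext h
  ext x
  exact LinearMap.congr_fun h1 ((tensorsEquiv K n r).symm x)

/-- Place permutation: `v₁ ⊗ ⋯ ⊗ v_r ↦ v_{σ 1} ⊗ ⋯ ⊗ v_{σ r}`. -/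
def permuteK (K : Type*) [Field K] (n : ℕ) {r : ℕ} (σ : Equiv.Perm (Fin r)) :
    Module.End K (Tensors K n r) :=
  (tensorsEquiv K n r).toLinearMap ∘ₗ
    (PiTensorProduct.reindex K (fun _ : Fin r => (Fin n → K)) σ.symm).toLinearMap ∘ₗ
      (tensorsEquiv K n r).symm.toLinearMap

theorem permuteK_tmul (K : Type*) [Field K] (n : ℕ) {r : ℕ} (σ : Equiv.Perm (Fin r))
    (v : Fin r → Fin n → K) :
    permuteK K n σ (tmul K n r v) = tmul K n r (fun i => v (σ i)) :=
  PiTensorProduct.reindex_tprod (R := K) (s := fun _ : Fin r => (Fin n → K)) σ.symm v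

/-- The endomorphisms of tensor space that commute with the place permutations. -/
def schurSubalgebra (K : Type*) [Field K] (n r : ℕ) :
    Subalgebra K (Module.End K (Tensors K n r)) :=
  Subalgebra.centralizer K (Set.range (permuteK K n (r := r)))

/-- The Schur algebra `S_K(n,r) = End_{𝔖_r}(V^{⊗ r})`. -/
def SchurAlgebra (K : Type*) [Field K] (n r : ℕ) : Type _ := schurSubalgebra K n r

instance instRingSchurAlgebra (K : Type*) [Field K] (n r : ℕ) : Ring (SchurAlgebra K n r) :=
  inferInstanceAs (Ring (schurSubalgebra K n r))

instance instAlgebraSchurAlgebra (K : Type*) [Field K] (n r : ℕ) :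
    Algebra K (SchurAlgebra K n r) :=
  inferInstanceAs (Algebra K (schurSubalgebra K n r))

/-- The tautological action of the Schur algebra on tensor space. -/
instance instModuleSchurAlgebra (K : Type*) [Field K] (n r : ℕ) :
    Module (SchurAlgebra K n r) (Tensors K n r) :=
  inferInstanceAs (Module (schurSubalgebra K n r) (Tensors K n r))

instance instIsScalarTowerSchurAlgebra (K : Type*) [Field K] (n r : ℕ) :
    IsScalarTower K (SchurAlgebra K n r) (Tensors K n r) :=
  inferInstanceAs (IsScalarTower K (schurSubalgebra K n r) (Tensors K n r))

/-- The endomorphism of tensor space underlying an element of the Schur algebra. -/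
def SchurAlgebra.toEnd {K : Type*} [Field K] {n r : ℕ} (ξ : SchurAlgebra K n r) :
    Module.End K (Tensors K n r) :=
  Subtype.val (p := fun f => f ∈ schurSubalgebra K n r) ξ

theorem SchurAlgebra.smul_eq {K : Type*} [Field K] {n r : ℕ} (ξ : SchurAlgebra K n r)
    (x : Tensors K n r) : ξ • x = ξ.toEnd x := rfl

theorem SchurAlgebra.permuteK_toEnd {K : Type*} [Field K] {n r : ℕ} (ξ : SchurAlgebra K n r)
    (σ : Equiv.Perm (Fin r)) (x : Tensors K n r) :
    permuteK K n σ (ξ.toEnd x) = ξ.toEnd (permuteK K n σ x) :=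
  LinearMap.congr_fun ((Subalgebra.mem_centralizer_iff K).1
    (Subtype.property (p := fun f => f ∈ schurSubalgebra K n r) ξ) _ ⟨σ, rfl⟩) x

/-- Place permutation, as a homomorphism of modules over the Schur algebra. -/
def permute (K : Type*) [Field K] (n : ℕ) {r : ℕ} (σ : Equiv.Perm (Fin r)) :
    Tensors K n r →ₗ[SchurAlgebra K n r] Tensors K n r where
  toFun := permuteK K n σ
  map_add' := map_add _
  map_smul' := by
    intro ξ x
    exact ξ.permuteK_toEnd σ x

theorem permute_tmul (K : Type*) [Field K] (n : ℕ) {r : ℕ} (σ : Equiv.Perm (Fin r))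
    (v : Fin r → Fin n → K) :
    permute K n σ (tmul K n r v) = tmul K n r (fun i => v (σ i)) :=
  permuteK_tmul K n σ v

theorem permute_permute (K : Type*) [Field K] (n : ℕ) {r : ℕ} (σ τ : Equiv.Perm (Fin r))
    (x : Tensors K n r) : permute K n σ (permute K n τ x) = permute K n (τ * σ) x := by
  have h : permuteK K n σ ∘ₗ permuteK K n τ = permuteK K n (τ * σ) := by
    apply tensors_hom_ext
    intro v
    simp [permuteK_tmul]
  exact LinearMap.congr_fun h x

/-! ## Tensor products of divided powers -/

/-- Let `ρ` label the `r` tensor positions, and let `ν i` be the number of positions labelled `i`.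
`DivPow K n ρ` is the tensor product `D(ν) = ⨂ᵢ D_{ν i} V`, the factor `D_{ν i} V` occupying the
positions labelled `i`. Here the divided power `D_a V`, the dual of the symmetric power
`S_a(V^*)`, is realised in the usual way as the space of symmetric tensors in `V^{⊗ a}`: `D(ν)`
consists of the tensors that are fixed by all place permutations preserving the labels. The
divided power monomial `∏ e_j^{(c_j)}` is the sum of all distinct rearrangements of the pure
tensor in which each `e_j` occurs `c_j` times. -/
def DivPow (K : Type*) [Field K] (n : ℕ) {r : ℕ} {ι : Type*} (ρ : Fin r → ι) :
    Submodule (SchurAlgebra K n r) (Tensors K n r) :=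
  ⨅ (σ : Equiv.Perm (Fin r)) (_ : ρ ∘ σ = ρ), LinearMap.eqLocus (permute K n σ) LinearMap.id

theorem mem_DivPow {K : Type*} [Field K] {n r : ℕ} {ι : Type*} {ρ : Fin r → ι}
    {x : Tensors K n r} :
    x ∈ DivPow K n ρ ↔ ∀ σ : Equiv.Perm (Fin r), ρ ∘ σ = ρ → permute K n σ x = x := by
  simp [DivPow, LinearMap.mem_eqLocus]

/-- `t` is a rearrangement of the labelling `ρ` (each label is used equally often by both). -/
def IsRearrangement {r : ℕ} {ι : Type*} (ρ t : Fin r → ι) : Prop :=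
  ∃ β : Equiv.Perm (Fin r), ρ ∘ β = t

theorem permute_mem_DivPow {K : Type*} [Field K] {n r : ℕ} {ι : Type*} {ρ t : Fin r → ι}
    (β : Equiv.Perm (Fin r)) (hβ : ρ ∘ β = t) {x : Tensors K n r} (hx : x ∈ DivPow K n ρ) :
    permute K n β x ∈ DivPow K n t := by
  rw [mem_DivPow] at hx ⊢
  intro σ hσ
  have h1 : ρ ∘ (β * σ * β⁻¹ : Equiv.Perm (Fin r)) = ρ := by
    funext i
    have := congrFun hσ (β⁻¹ i)
    rw [← hβ] at this
    simpa using this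
  have h2 := congrArg (permute K n β) (hx _ h1)
  rw [permute_permute] at h2 ⊢
  simpa [mul_assoc] using h2

open Classical in
/-- The canonical isomorphism `D(ρ) → D(t)`, where `t` is a rearrangement of the labelling `ρ`.
It is the identity of `⨂ᵢ D_{ν i} V`, the factors being moved from the positions prescribed by `ρ`
to those prescribed by `t`. It does not depend on the permutation used (`place_eq`); the value is
`0` if `t` is not a rearrangement of `ρ`. -/
def place (K : Type*) [Field K] (n : ℕ) {r : ℕ} {ι : Type*} (ρ t : Fin r → ι) :
    DivPow K n ρ →ₗ[SchurAlgebra K n r] DivPow K n t :=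
  if h : IsRearrangement ρ t then
    ((permute K n h.choose).comp (DivPow K n ρ).subtype).codRestrict (DivPow K n t)
      (fun x => permute_mem_DivPow h.choose h.choose_spec x.2)
  else 0

theorem place_eq {K : Type*} [Field K] {n r : ℕ} {ι : Type*} {ρ t : Fin r → ι}
    (β : Equiv.Perm (Fin r)) (hβ : ρ ∘ β = t) (x : DivPow K n ρ) :
    (place K n ρ t x : Tensors K n r) = permute K n β (x : Tensors K n r) := by
  have h : IsRearrangement ρ t := ⟨β, hβ⟩
  have h0 : (place K n ρ t x : Tensors K n r) = permute K n h.choose (x : Tensors K n r) := by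
    simp [place, h]
  rw [h0]
  have hs := h.choose_spec
  have h1 : ρ ∘ (h.choose * β⁻¹ : Equiv.Perm (Fin r)) = ρ := by
    funext i
    have := congrFun (hs.trans hβ.symm) (β⁻¹ i)
    simpa using this
  have h2 := congrArg (permute K n β) (mem_DivPow.1 x.2 _ h1)
  rw [permute_permute] at h2
  simpa using h2

/-- Comultiplication components. If the labelling `ρ'` refines `ρ = f ∘ ρ'`, every factor of
`D(ρ)` is sent to the tensor product of several factors of `D(ρ')` by the component
`D_{a+b+⋯} V → D_a V ⊗ D_b V ⊗ ⋯` of the diagonalization of `DV`. In terms of symmetric tensors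
this is the inclusion. -/
def comul (K : Type*) [Field K] (n : ℕ) {r : ℕ} {ι κ : Type*} (f : ι → κ) (ρ' : Fin r → ι) :
    DivPow K n (f ∘ ρ') →ₗ[SchurAlgebra K n r] DivPow K n ρ' :=
  Submodule.inclusion (by
    intro x hx
    rw [mem_DivPow] at hx ⊢
    intro σ hσ
    exact hx σ (by rw [Function.comp_assoc, hσ]))

open Classical in
/-- The labellings that arise from `ρ'` by rearrangement and induce the same labelling
under `f`. -/
def shuffles {r : ℕ} {ι κ : Type*} [Fintype ι] (f : ι → κ) (ρ' : Fin r → ι) :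
    Finset (Fin r → ι) :=
  Finset.univ.filter (fun t => IsRearrangement ρ' t ∧ f ∘ t = f ∘ ρ')

theorem mem_shuffles {r : ℕ} {ι κ : Type*} [Fintype ι] {f : ι → κ} {ρ' t : Fin r → ι} :
    t ∈ shuffles f ρ' ↔ IsRearrangement ρ' t ∧ f ∘ t = f ∘ ρ' := by
  simp [shuffles]

theorem sum_place_mem {K : Type*} [Field K] {n r : ℕ} {ι κ : Type*} [Fintype ι] (f : ι → κ)
    (ρ' : Fin r → ι) (x : DivPow K n ρ') :
    (∑ t ∈ shuffles f ρ', (place K n ρ' t x : Tensors K n r)) ∈ DivPow K n (f ∘ ρ') := by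
  rw [mem_DivPow]
  intro σ hσ
  rw [map_sum]
  have key : ∀ τ : Equiv.Perm (Fin r), (f ∘ ρ') ∘ τ = f ∘ ρ' → ∀ t ∈ shuffles f ρ',
      t ∘ τ ∈ shuffles f ρ' := by
    intro τ hτ t ht
    rw [mem_shuffles] at ht ⊢
    obtain ⟨⟨β, hβ⟩, h2⟩ := ht
    refine ⟨⟨β * τ, ?_⟩, ?_⟩
    · rw [← hβ]; rfl
    · rw [← Function.comp_assoc, h2, hτ]
  have hσ' : (f ∘ ρ') ∘ (σ⁻¹ : Equiv.Perm (Fin r)) = f ∘ ρ' := by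
    funext i
    have := congrFun hσ (σ⁻¹ i)
    simpa using this.symm
  refine Finset.sum_bij' (fun t _ => t ∘ σ) (fun t _ => t ∘ (σ⁻¹ : Equiv.Perm (Fin r)))
    (fun t ht => key σ hσ t ht) (fun t ht => key σ⁻¹ hσ' t ht) ?_ ?_ ?_
  · intro t _; funext i; simp
  · intro t _; funext i; simp
  · intro t ht
    obtain ⟨⟨β, hβ⟩, -⟩ := mem_shuffles.1 ht
    rw [place_eq β hβ x, place_eq (β * σ) (by rw [← hβ]; rfl) x, permute_permute]

/-- Multiplication. For a labelling `ρ'` and a map `f` of labels, the factors of `D(ρ')` whose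
labels have the same image under `f` are multiplied in the divided power algebra `DV`. The product
of symmetric tensors is the shuffle product: the sum over all the different ways to distribute
the factors over the positions that are available to them. -/
def mul (K : Type*) [Field K] (n : ℕ) {r : ℕ} {ι κ : Type*} [Fintype ι] (f : ι → κ)
    (ρ' : Fin r → ι) :
    DivPow K n ρ' →ₗ[SchurAlgebra K n r] DivPow K n (f ∘ ρ') :=
  (∑ t ∈ shuffles f ρ', (DivPow K n t).subtype.comp (place K n ρ' t)).codRestrict
    (DivPow K n (f ∘ ρ'))
    (fun x => by simpa [LinearMap.sum_apply] using sum_place_mem f ρ' x)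

/-! ## Tensor products of exterior powers -/

/-- The pure tensors with equal entries at two different positions of the same label. -/
def repeated (K : Type*) [Field K] (n : ℕ) {r : ℕ} {κ : Type*} (γ : Fin r → κ) :
    Set (Tensors K n r) :=
  {x | ∃ (v : Fin r → Fin n → K) (a b : Fin r), a ≠ b ∧ γ a = γ b ∧ v a = v b ∧
    x = tmul K n r v}

theorem mem_span_repeated_of_swap {K : Type*} [Field K] {n r : ℕ} {κ : Type*} {γ : Fin r → κ}
    {a b : Fin r} (hab : a ≠ b) (hγ : γ a = γ b) {x : Tensors K n r}
    (hx : permuteK K n (Equiv.swap a b) x = x) : x ∈ Submodule.span K (repeated K n γ) := by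
  classical
  set e : (Fin r → Fin n) → Tensors K n r :=
    fun w => tmul K n r (fun i => Pi.single (w i) (1 : K)) with he
  set B := (Basis.piTensorProduct (fun _ : Fin r => Pi.basisFun K (Fin n))).map
    (tensorsEquiv K n r) with hB
  have hBe : ∀ w, B w = e w := by
    intro w
    simp [hB, he, Basis.piTensorProduct_apply, tmul]
  set τ : Equiv.Perm (Fin r) := Equiv.swap a b with hτ
  have hpe : ∀ w : Fin r → Fin n, permuteK K n τ (e w) = e (w ∘ τ) := by
    intro w
    simp only [he, permuteK_tmul]
    rfl
  have hττ : ∀ w : Fin r → Fin n, (w ∘ τ) ∘ τ = w := by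
    intro w; funext i; simp [hτ]
  set c : (Fin r → Fin n) → K := fun w => B.repr x w with hc
  have hsum : x = ∑ w, c w • e w := by
    rw [← B.sum_repr x]
    simp [hc, hBe]
  have hsum' : x = ∑ w, c (w ∘ τ) • e w := by
    calc x = permuteK K n τ x := hx.symm
      _ = ∑ w, c w • e (w ∘ τ) := by
        conv_lhs => rw [hsum]
        simp [map_sum, hpe]
      _ = ∑ w, c (w ∘ τ) • e w := by
        refine Finset.sum_bij' (fun w _ => w ∘ τ) (fun w _ => w ∘ τ) (by simp) (by simp)
          (fun w _ => hττ w) (fun w _ => hττ w) (fun w _ => by rw [hττ])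
  have hinv : ∀ w, c (w ∘ τ) = c w := by
    intro w
    have h1 : B.repr x w = c (w ∘ τ) := by
      conv_lhs => rw [hsum']
      simp only [← hBe]
      simp only [map_sum, map_smul, Module.Basis.repr_self, Finsupp.coe_finsetSum, Finset.sum_apply,
        Finsupp.smul_apply, Finsupp.single_apply, smul_eq_mul]
      simp
    exact h1.symm
  have heq : ∀ w : Fin r → Fin n, w a = w b → e w ∈ Submodule.span K (repeated K n γ) := by
    intro w hw
    exact Submodule.subset_span ⟨_, a, b, hab, hγ, by simp [hw], rfl⟩
  have hpair : ∀ w : Fin r → Fin n, e w + e (w ∘ τ) ∈ Submodule.span K (repeated K n γ) := by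
    intro w
    set u : Fin r → Fin n → K := fun i => Pi.single (w i) (1 : K) with hu
    have h0 : ∀ y z : Fin n → K, Function.update (Function.update u a y) b z
        = Function.update (Function.update u b z) a y := by
      intro y z; rw [Function.update_comm hab]
    have hdiag : ∀ y : Fin n → K, tmul K n r
        (Function.update (Function.update u a y) b y) ∈ Submodule.span K (repeated K n γ) := by
      intro y
      exact Submodule.subset_span ⟨_, a, b, hab, hγ, by simp [Function.update_of_ne hab], rfl⟩
    have hexp : tmul K n r (Function.update (Function.update u a (u a + u b)) b
        (u a + u b)) =
        tmul K n r (Function.update (Function.update u a (u a)) b (u a)) +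
        tmul K n r (Function.update (Function.update u a (u b)) b (u b)) +
        (e w + e (w ∘ τ)) := by
      have e1 : e w = tmul K n r
          (Function.update (Function.update u a (u a)) b (u b)) := by
        simp [he, hu]
      have e2 : e (w ∘ τ) = tmul K n r
          (Function.update (Function.update u a (u b)) b (u a)) := by
        simp only [he]
        congr 1
        funext i
        by_cases hib : i = b
        · subst hib; simp [hu, hτ]
        · by_cases hia : i = a
          · subst hia; simp [hu, hτ, Function.update_of_ne hib]
          · simp [hu, hτ, Function.update_of_ne hib, Function.update_of_ne hia,
              Equiv.swap_apply_of_ne_of_ne hia hib]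
      rw [e1, e2, MultilinearMap.map_update_add, h0, h0, MultilinearMap.map_update_add,
        MultilinearMap.map_update_add, h0 (u a) (u a), h0 (u b) (u b), h0 (u a) (u b),
        h0 (u b) (u a)]
      abel
    have h1 := hdiag (u a + u b)
    rw [hexp] at h1
    have h2 := Submodule.add_mem _ (hdiag (u a)) (hdiag (u b))
    exact (Submodule.add_mem_iff_right _ h2).1 h1
  -- split the words according to the order of their entries at `a` and `b`
  have hsplit : x = ∑ w, ((if w a = w b then c w • e w else 0) +
      (if w a < w b then c w • (e w + e (w ∘ τ)) else 0)) := by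
    have hgt : ∑ w : Fin r → Fin n, (if w a < w b then c w • e (w ∘ τ) else 0) =
        ∑ w : Fin r → Fin n, (if w b < w a then c w • e w else 0) := by
      refine Finset.sum_bij' (fun w _ => w ∘ τ) (fun w _ => w ∘ τ) (by simp) (by simp)
          (fun w _ => hττ w) (fun w _ => hττ w) (fun w _ => ?_)
      rw [hinv]
      simp [hτ]
    have hlt : ∀ w : Fin r → Fin n, (if w a < w b then c w • (e w + e (w ∘ τ)) else 0) =
        (if w a < w b then c w • e w else 0) + (if w a < w b then c w • e (w ∘ τ) else 0) := by
      intro w; split_ifs <;> simp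
    simp only [hlt]
    rw [Finset.sum_add_distrib, Finset.sum_add_distrib, hgt, ← Finset.sum_add_distrib,
      ← Finset.sum_add_distrib]
    conv_lhs => rw [hsum]
    refine Finset.sum_congr rfl fun w _ => ?_
    rcases lt_trichotomy (w a) (w b) with h | h | h
    · simp [h, h.ne, h.not_gt]
    · simp [h]
    · simp [h, h.ne', h.not_gt]
  rw [hsplit]
  refine Submodule.sum_mem _ fun w _ => Submodule.add_mem _ ?_ ?_
  · split_ifs with h
    · exact Submodule.smul_mem _ _ (heq w h)
    · exact Submodule.zero_mem _
  · split_ifs with h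
    · exact Submodule.smul_mem _ _ (hpair w)
    · exact Submodule.zero_mem _

/-- The `K`-span of `repeated`; it is stable under the Schur algebra. -/
def exteriorRel (K : Type*) [Field K] (n : ℕ) {r : ℕ} {κ : Type*} (γ : Fin r → κ) :
    Submodule (SchurAlgebra K n r) (Tensors K n r) where
  carrier := Submodule.span K (repeated K n γ)
  add_mem' := fun hx hy => Submodule.add_mem _ hx hy
  zero_mem' := Submodule.zero_mem _
  smul_mem' := by
    intro ξ x hx
    have h : Submodule.span K (repeated K n γ) ≤
        (Submodule.span K (repeated K n γ)).comap ξ.toEnd := by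
      rw [Submodule.span_le]
      rintro _ ⟨v, a, b, hab, hγ, hv, rfl⟩
      refine mem_span_repeated_of_swap hab hγ ?_
      have hs := (permute K n (Equiv.swap a b)).map_smul ξ (tmul K n r v)
      have hfix : permute K n (Equiv.swap a b) (tmul K n r v) =
          tmul K n r v := by
        rw [permute_tmul]
        congr 1
        funext i
        by_cases hia : i = a
        · subst hia; simp [hv]
        · by_cases hib : i = b
          · subst hib; simp [hv]
          · rw [Equiv.swap_apply_of_ne_of_ne hia hib]
      rw [hfix] at hs
      exact hs
    exact h hx

/-- Let `γ` label the tensor positions, and let `c j` be the number of positions labelled `j`.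
`Ext K n γ` is the tensor product of exterior powers `Λ(c) = ⨂ⱼ Λ^{c j} V`, the factor
`Λ^{c j} V` occupying the positions labelled `j`: the quotient of `V^{⊗ r}` by the span of the pure
tensors having equal entries at two positions of the same label. -/
abbrev Ext (K : Type*) [Field K] (n : ℕ) {r : ℕ} {κ : Type*} (γ : Fin r → κ) : Type _ :=
  Tensors K n r ⧸ exteriorRel K n γ

/-! ## Partitions, Weyl modules, tableaux -/

/-- Partitions `(part 0 ≥ part 1 ≥ ⋯ ≥ part (m-1))` of `r` with at most `m` parts; zero parts
are allowed. -/
structure Parts (m r : ℕ) where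
  part : Fin m → ℕ
  anti : Antitone part
  sum_eq : ∑ i, part i = r

/-- The boxes of the diagram of a partition of `r`, numbered by `Fin r` row after row. -/
def Parts.boxEquiv {m r : ℕ} (lam : Parts m r) : ((i : Fin m) × Fin (lam.part i)) ≃ Fin r :=
  finSigmaFinEquiv.trans (finCongr lam.sum_eq)

/-- The row of a box. -/
def Parts.row {m r : ℕ} (lam : Parts m r) (b : Fin r) : Fin m := (lam.boxEquiv.symm b).1

/-- The column of a box (columns are counted from `0`). -/
def Parts.col {m r : ℕ} (lam : Parts m r) (b : Fin r) : ℕ := ((lam.boxEquiv.symm b).2 : ℕ)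

/-- `D(λ) = D_{λ₁} V ⊗ ⋯ ⊗ D_{λ_m} V`, the rows of the diagram being the tensor factors. -/
abbrev D (K : Type*) [Field K] (n : ℕ) {m r : ℕ} (lam : Parts m r) :
    Submodule (SchurAlgebra K n r) (Tensors K n r) :=
  DivPow K n lam.row

/-- The map `d'_λ : D(λ) → Λ(λᵗ)`: each `D_{λ_i} V` is diagonalized into `V ⊗ ⋯ ⊗ V`, one factor
for each box of row `i`, and then the factors belonging to each column are multiplied in the
exterior algebra. -/
def dMap (K : Type*) [Field K] (n : ℕ) {m r : ℕ} (lam : Parts m r) :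
    D K n lam →ₗ[SchurAlgebra K n r] Ext K n lam.col :=
  (exteriorRel K n lam.col).mkQ.comp (D K n lam).subtype

/-- The Weyl module `Δ(λ)`, the image of `d'_λ`, as a module over the Schur algebra. -/
abbrev Weyl (K : Type*) [Field K] (n : ℕ) {m r : ℕ} (lam : Parts m r) :
    Submodule (SchurAlgebra K n r) (Ext K n lam.col) :=
  LinearMap.range (dMap K n lam)

/-- `d'_λ` as a surjection `D(λ) → Δ(λ)`. -/
def toWeyl (K : Type*) [Field K] (n : ℕ) {m r : ℕ} (lam : Parts m r) :
    D K n lam →ₗ[SchurAlgebra K n r] Weyl K n lam :=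
  (dMap K n lam).rangeRestrict

open Classical in
/-- `ST_λ(μ)`: the standard tableaux of shape `μ` and weight `λ`, i.e. the fillings of the diagram
of `μ` in which each `s` occurs `λ_s` times, with rows weakly increasing and columns strictly
increasing. (As `λ` has at most `m` parts, the entries lie in `{1, …, m}`, here `Fin m`.) -/
def ST {k m r : ℕ} (lam : Parts m r) (mu : Parts k r) : Finset (Fin r → Fin m) :=
  Finset.univ.filter (fun T =>
    (∀ s, (Finset.univ.filter (fun b => T b = s)).card = lam.part s) ∧
    (∀ b c, mu.row b = mu.row c → mu.col b ≤ mu.col c → T b ≤ T c) ∧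
    (∀ b c, mu.col b = mu.col c → mu.row b < mu.row c → T b < T c))

/-- A filling of weight `λ` is a rearrangement of the row labelling of the diagram of `λ`, so
that `place` is a genuine isomorphism in `phi`. -/
theorem isRearrangement_of_weight {m r : ℕ} (lam : Parts m r) (T : Fin r → Fin m)
    (hT : ∀ s, (Finset.univ.filter (fun b => T b = s)).card = lam.part s) :
    IsRearrangement lam.row T := by
  classical
  have hrow : ∀ s, Fintype.card {b // lam.row b = s} = lam.part s := by
    intro s
    have e : {b // lam.row b = s} ≃ Fin (lam.part s) :=
      (Equiv.subtypeEquiv lam.boxEquiv.symm (q := fun x => x.1 = s) (fun b => Iff.rfl)).trans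
        (Equiv.sigmaSubtype s)
    simpa using Fintype.card_congr e
  have e : ∀ s, Nonempty ({b // T b = s} ≃ {b // lam.row b = s}) := by
    intro s
    rw [← Fintype.card_eq, hrow, Fintype.card_subtype, hT]
  refine ⟨(Equiv.sigmaFiberEquiv T).symm.trans
    ((Equiv.sigmaCongrRight fun s => (e s).some).trans (Equiv.sigmaFiberEquiv lam.row)), ?_⟩
  funext b
  exact ((e (T b)).some ⟨b, rfl⟩).2

/-- The map `φ_T : D(λ) → Δ(μ)` of a filling `T` of the diagram of `μ` of weight `λ`. If `a_{s,i}`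
is the number of occurrences of `s` in row `i` of `T`, then each factor `D_{λ_s} V` is
comultiplied into `⨂ᵢ D_{a_{s,i}} V`; next, for each row `i`, the components in the
`D_{a_{s,i}} V` are multiplied to give an element of `D_{μ_i} V`; finally `d'_μ` is applied. Here
the tensor positions are the boxes of `μ`, and the factor `D_{a_{s,i}} V` occupies the boxes of
row `i` with entry `s`, that is those with label `(s, i)`. -/
def phi (K : Type*) [Field K] (n : ℕ) {k m r : ℕ} (lam : Parts m r) (mu : Parts k r)
    (T : Fin r → Fin m) : D K n lam →ₗ[SchurAlgebra K n r] Weyl K n mu :=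
  (toWeyl K n mu).comp
    ((mul K n (Prod.snd : Fin m × Fin k → Fin k) (fun b => (T b, mu.row b))).comp
      ((comul K n (Prod.fst : Fin m × Fin k → Fin m) (fun b => (T b, mu.row b))).comp
        (place K n lam.row T)))

/-- `R(x,y) = gcd {C(x,1), C(x+1,2), …, C(x+y-1,y)}`, and `R(x,0) = 0`. -/
def R (x y : ℕ) : ℕ := (Finset.Icc 1 y).gcd (fun j => (x + j - 1).choose j)

end

end WeylHom

/-! Everything is transferred to functions `h` on words `w : Fin r → Fin m`: such a function sends
`x ∈ D(λ)` to `wordSum x h`, the combination of the copies of `x` placed along the words. Let `o` be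
the first letter. Since `mu.part 1 ≤ lam.part o`, a word of weight λ with no `o` in the second row
of μ becomes a standard tableau once its rows are sorted. Hence `ψ` is `wordSum` of the indicator
function `rowWordFun` of these words, modulo the exterior relations (`coe_sum_phi_apply`).

In every characteristic the exterior relations are the kernel of the signed column sum
(`antisymmetrizer_eq_zero_of_mem`, `mem_exteriorRel_of_antisymmetrizer_eq_zero`), and
antisymmetrizing `wordSum x h` amounts to alternating `h` (`antisymmetrizer_wordSum`). So `ψ`
factors through `Δ(λ)` if the alternation of `rowWordFun` over the columns of μ annihilates the
kernel of `d'_λ`. Polytabloids of shape λ do so, because they act through the antisymmetrizer of the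
columns of λ (`wordSum_polytabloid`). James' kernel intersection theorem
(`kernelIntersection_le_span`) places the alternation in their span once certain sums over lowerings
of adjacent letters vanish. These sums count words: they are built from the binomials `C(λ_i + t,
t)` for `i ≠ o` and `C(λ_o - μ_2 + t, t)` for `o`, and the divisibility of `R` makes all of these
zero in `K` (`alternation_mem_kernelIntersection`).

The induced map is nonzero because the alternation takes the value 1 at `lam.row`
(`alternation_row_eq_one`), and the tensor with distinct basis vectors in distinct rows, available
as `m ≤ r ≤ n`, detects every coefficient (`wordSum_rowTensor_ne_zero`). -/

namespace WeylHom

open Finset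

/-! ## Boxes of a diagram -/

section Boxes

variable {m r : ℕ} (lam : Parts m r)

theorem Parts.col_lt (b : Fin r) : lam.col b < lam.part (lam.row b) :=
  (lam.boxEquiv.symm b).2.2

theorem Parts.row_boxEquiv (x : (i : Fin m) × Fin (lam.part i)) :
    lam.row (lam.boxEquiv x) = x.1 := by
  simp [Parts.row]

theorem Parts.col_boxEquiv (x : (i : Fin m) × Fin (lam.part i)) :
    lam.col (lam.boxEquiv x) = x.2 := by
  rw [Parts.col, Equiv.symm_apply_apply]

theorem Parts.exists_box {i : Fin m} {c : ℕ} (hc : c < lam.part i) :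
    ∃ b, lam.row b = i ∧ lam.col b = c :=
  ⟨lam.boxEquiv ⟨i, ⟨c, hc⟩⟩, lam.row_boxEquiv _, lam.col_boxEquiv _⟩

theorem Parts.box_ext {b b' : Fin r} (h1 : lam.row b = lam.row b') (h2 : lam.col b = lam.col b') :
    b = b' := by
  obtain ⟨⟨i, c⟩, rfl⟩ := lam.boxEquiv.surjective b
  obtain ⟨⟨i', c'⟩, rfl⟩ := lam.boxEquiv.surjective b'
  simp only [Parts.row_boxEquiv, Parts.col_boxEquiv] at h1 h2
  subst h1
  rw [Fin.ext h2]

theorem Parts.box_val (b : Fin r) :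
    (b : ℕ) = ∑ j with j < lam.row b, lam.part j + lam.col b := by
  obtain ⟨⟨i, c⟩, rfl⟩ := lam.boxEquiv.surjective b
  rw [Parts.row_boxEquiv, Parts.col_boxEquiv]
  simp only [Parts.boxEquiv, Equiv.trans_apply, finCongr_apply, Fin.val_cast,
    finSigmaFinEquiv_apply]
  congr 1
  refine Finset.sum_bij (fun j _ => Fin.castLE i.2.le j) ?_ ?_ ?_ ?_
  · intro j _
    simp only [mem_filter_univ]
    exact j.2
  · intro j _ j' _ h
    simpa [Fin.ext_iff] using h
  · intro j hj
    exact ⟨⟨j, by simpa using hj⟩, mem_univ _, rfl⟩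
  · intro j _
    rfl

theorem Parts.lt_of_row_lt {b b' : Fin r} (h : lam.row b < lam.row b') : b < b' := by
  rw [Fin.lt_def, lam.box_val b, lam.box_val b']
  have h1 : insert (lam.row b) (univ.filter (· < lam.row b)) ⊆ univ.filter (· < lam.row b') := by
    intro j
    simp only [mem_insert, mem_filter_univ]
    rintro (rfl | hj)
    · exact h
    · exact hj.trans h
  have h2 := Finset.sum_le_sum_of_subset (f := lam.part) h1
  rw [Finset.sum_insert (by simp)] at h2
  have := lam.col_lt b
  omega

theorem Parts.row_monotone : Monotone lam.row := by
  intro b b' h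
  by_contra! h'
  exact absurd (lam.lt_of_row_lt h') (not_lt.2 h)

theorem Parts.col_le_iff {b b' : Fin r} (h : lam.row b = lam.row b') :
    lam.col b ≤ lam.col b' ↔ b ≤ b' := by
  rw [Fin.le_def, lam.box_val b, lam.box_val b', h]
  omega

/-- The words in which each letter `s` occurs `λ_s` times. -/
def HasWeight (w : Fin r → Fin m) : Prop :=
  ∀ s, #{b | w b = s} = lam.part s

variable {lam}

theorem HasWeight.comp {w : Fin r → Fin m} (h : HasWeight lam w) (σ : Equiv.Perm (Fin r)) :
    HasWeight lam (w ∘ σ) := by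
  intro s
  rw [← h s]
  exact Finset.card_equiv σ (by simp)

theorem hasWeight_comp_iff {w : Fin r → Fin m} (σ : Equiv.Perm (Fin r)) :
    HasWeight lam (w ∘ σ) ↔ HasWeight lam w := by
  refine ⟨fun h => ?_, fun h => h.comp σ⟩
  have e : (w ∘ σ) ∘ (σ⁻¹ : Equiv.Perm (Fin r)) = w := by
    funext x
    simp
  exact e ▸ h.comp σ⁻¹

theorem HasWeight.isRearrangement {w : Fin r → Fin m} (h : HasWeight lam w) :
    IsRearrangement lam.row w :=
  isRearrangement_of_weight lam w h

variable (lam)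

theorem hasWeight_row : HasWeight lam lam.row := by
  intro s
  rw [← Fintype.card_fin (lam.part s), ← Finset.card_univ]
  symm
  refine Finset.card_bij (fun c _ => lam.boxEquiv ⟨s, c⟩) ?_ ?_ ?_
  · intro c _
    simp [Parts.row_boxEquiv]
  · intro c _ c' _ h
    simpa using h
  · intro b hb
    obtain ⟨⟨i, c⟩, rfl⟩ := lam.boxEquiv.surjective b
    simp only [Parts.row_boxEquiv, mem_filter_univ] at hb
    subst hb
    exact ⟨c, mem_univ _, rfl⟩

theorem hasWeight_row_comp (β : Equiv.Perm (Fin r)) : HasWeight lam (lam.row ∘ β) :=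
  (hasWeight_row lam).comp β

end Boxes

/-! ## Lowering letters of a word -/

section Lowers

variable {m r : ℕ}

/-- `w` arises from `s` by changing some letters `i` into `j`. -/
def Lowers (i j : Fin m) (s w : Fin r → Fin m) : Prop :=
  ∀ x, w x = s x ∨ (s x = i ∧ w x = j)

instance (i j : Fin m) (s : Fin r → Fin m) : DecidablePred (Lowers i j s) := fun w => by
  unfold Lowers; infer_instance

theorem lowers_comp_iff {i j : Fin m} {s w : Fin r → Fin m} (σ : Equiv.Perm (Fin r)) :
    Lowers i j (s ∘ σ) (w ∘ σ) ↔ Lowers i j s w := by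
  refine ⟨fun h x => ?_, fun h x => h (σ x)⟩
  simpa using h (σ⁻¹ x)

theorem sum_lowers_comp {M : Type*} [AddCommMonoid M] {i j : Fin m} {s : Fin r → Fin m}
    (σ : Equiv.Perm (Fin r)) (f : (Fin r → Fin m) → M) :
    ∑ w with Lowers i j (s ∘ σ) w, f w = ∑ w with Lowers i j s w, f (w ∘ σ) := by
  symm
  refine Finset.sum_bij' (fun w _ => w ∘ σ) (fun w _ => w ∘ (σ⁻¹ : Equiv.Perm (Fin r))) ?_ ?_ ?_ ?_ ?_
  · intro w hw
    simpa [lowers_comp_iff] using hw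
  · intro w hw
    rw [mem_filter_univ] at hw ⊢
    rw [← lowers_comp_iff σ]
    convert hw using 1
    funext x
    simp
  · intro w _
    funext x
    simp
  · intro w _
    funext x
    simp
  · intro w _
    rfl

/-- The functions on words of weight `λ` that are annihilated by all the maps which collect
entries of row `i + 1` in row `i`. -/
def kernelIntersection (K : Type*) [Field K] (lam : Parts m r) :
    Submodule K ((Fin r → Fin m) → K) where
  carrier := {h | (∀ w, h w ≠ 0 → HasWeight lam w) ∧ ∀ (i j : Fin m) (s : Fin r → Fin m),
    (i : ℕ) + 1 = j → lam.part i < #{x | s x = i} → ∑ w with Lowers i j s w, h w = 0}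
  zero_mem' := by simp
  add_mem' := by
    rintro f g ⟨hf, hf'⟩ ⟨hg, hg'⟩
    refine ⟨fun w hw => ?_, fun i j s hij hs => ?_⟩
    · by_contra hc
      apply hw
      simp [not_imp_comm.1 (hf w) hc, not_imp_comm.1 (hg w) hc]
    · simp [sum_add_distrib, hf' i j s hij hs, hg' i j s hij hs]
  smul_mem' := by
    rintro a f ⟨hf, hf'⟩
    refine ⟨fun w hw => hf w fun hc => hw (by simp [hc]), fun i j s hij hs => ?_⟩
    simp [← mul_sum, hf' i j s hij hs]

variable {K : Type*} [Field K] {lam : Parts m r}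

/-- Garnir relations. -/
theorem sum_lowers_fixing_eq_zero {h : (Fin r → Fin m) → K} (hh : h ∈ kernelIntersection K lam)
    {i j : Fin m} (hij : (i : ℕ) + 1 = j) (Z : Finset (Fin r)) :
    ∀ s : Fin r → Fin m, (∀ z ∈ Z, s z = i) → lam.part i + #Z < #{x | s x = i} →
      ∑ w with Lowers i j s w ∧ ∀ z ∈ Z, w z = i, h w = 0 := by
  induction Z using Finset.induction_on with
  | empty =>
    intro s _ hs
    simpa using hh.2 i j s hij (by simpa using hs)
  | insert a Z ha ih =>
    intro s hsZ hs
    have hne : j ≠ i := by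
      rintro rfl
      omega
    have hsa : s a = i := hsZ a (by simp)
    rw [card_insert_of_notMem ha] at hs
    have e1 := ih s (fun z hz => hsZ z (by simp [hz])) (by omega)
    have hcard : #{x | Function.update s a j x = i} + 1 = #{x | s x = i} := by
      rw [← card_erase_add_one (s := univ.filter fun x => s x = i) (a := a) (by simpa using hsa)]
      congr 2
      ext x
      by_cases hx : x = a
      · subst hx; simp [hne]
      · simp [hx]
    have e2 := ih (Function.update s a j) (fun z hz => by
      rw [Function.update_of_ne (by rintro rfl; exact ha hz)]
      exact hsZ z (by simp [hz])) (by omega)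
    rw [← Finset.sum_filter_add_sum_filter_not _ (fun w => w a = i)] at e1
    rw [filter_filter, filter_filter] at e1
    -- The words that lower `a` are the lowerings of `s` with `a` already lowered, to which the
    -- smaller `Z` applies.
    have e3 : univ.filter (fun w => (Lowers i j s w ∧ ∀ z ∈ Z, w z = i) ∧ ¬ w a = i) =
        univ.filter (fun w => Lowers i j (Function.update s a j) w ∧ ∀ z ∈ Z, w z = i) := by
      ext w
      simp only [mem_filter_univ]
      constructor
      · rintro ⟨⟨h1, h2⟩, h3⟩
        refine ⟨fun x => ?_, h2⟩
        by_cases hx : x = a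
        · subst hx
          rcases h1 x with h | h
          · exact absurd (h.trans hsa) h3
          · simp [h.2]
        · simpa [hx] using h1 x
      · rintro ⟨h1, h2⟩
        have h3 : w a = j := by
          rcases h1 a with h | h
          · simpa using h
          · exact h.2
        refine ⟨⟨fun x => ?_, h2⟩, by simp [h3, hne]⟩
        by_cases hx : x = a
        · subst hx
          exact Or.inr ⟨hsa, h3⟩
        · simpa [hx] using h1 x
    rw [e3, e2, add_zero] at e1
    rw [← e1]
    congr 1
    ext w
    simp only [mem_filter_univ, mem_insert, forall_eq_or_imp]
    tauto

/-! ### Leading words in the kernel intersection are ballot words -/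

/-- Every initial segment of a ballot word contains each letter at least as often as the next
one. -/
def IsBallot (T : Fin r → Fin m) : Prop :=
  ∀ (i j : Fin m) (x : Fin r), i ≤ j → #{y | y ≤ x ∧ T y = j} ≤ #{y | y ≤ x ∧ T y = i}

theorem isBallot_of_succ {T : Fin r → Fin m}
    (h : ∀ (i j : Fin m) (x : Fin r), (i : ℕ) + 1 = j →
      #{y | y ≤ x ∧ T y = j} ≤ #{y | y ≤ x ∧ T y = i}) : IsBallot T := by
  intro i j x hij
  obtain ⟨j, hj⟩ := j
  induction j with
  | zero =>
    have : i = ⟨0, hj⟩ := Fin.ext (by simpa [Fin.le_def] using hij)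
    rw [this]
  | succ j ih =>
    rcases hij.eq_or_lt with rfl | hlt
    · exact le_rfl
    · exact (h ⟨j, by omega⟩ _ x rfl).trans (ih _ (by
        rw [Fin.lt_def] at hlt
        rw [Fin.le_def]
        simp only at hlt ⊢
        omega))

/-- If up to `x` the letters `j` outnumber the letters `i`, turn these `j` into `i` and hold the
earlier `i` fixed. In the resulting Garnir relation every word of weight λ other than `T` lowers
some `i` beyond `x`, hence is colex larger. Only the term of `T` survives, which forces `h T = 0`.
-/
theorem isBallot_of_maximal {h : (Fin r → Fin m) → K} (hh : h ∈ kernelIntersection K lam)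
    {T : Fin r → Fin m} (hT : h T ≠ 0) (hmax : ∀ w, h w ≠ 0 → toColex w ≤ toColex T) :
    IsBallot T := by
  refine isBallot_of_succ fun i j x hij => ?_
  by_contra! hlt
  have hne : j ≠ i := by
    rintro rfl
    omega
  have hTw := hh.1 T hT
  set Z : Finset (Fin r) := {y | y ≤ x ∧ T y = i} with hZ
  set s : Fin r → Fin m := fun y => if y ≤ x ∧ T y = j then i else T y with hs
  have hscard : #{y | s y = i} = lam.part i + #{y | y ≤ x ∧ T y = j} := by
    rw [← hTw i, ← card_union_of_disjoint]
    · congr 1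
      ext y
      simp only [hs, mem_filter_univ, mem_union]
      split_ifs with hy
      · simp [hy]
      · simp [hy]
    · rw [disjoint_filter]
      rintro y _ hy ⟨_, hy'⟩
      exact hne (hy'.symm.trans hy)
  have hgar := sum_lowers_fixing_eq_zero hh hij Z s
    (fun z hz => by
      simp only [hZ, mem_filter_univ] at hz
      simp only [hs]
      rw [if_neg (by simp [hz.2, hne.symm]), hz.2])
    (by omega)
  rw [Finset.sum_eq_single T] at hgar
  · exact hT hgar
  · intro w hw hwT
    by_contra hw0
    rw [mem_filter_univ] at hw
    obtain ⟨hw1, hw2⟩ := hw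
    have hww := hh.1 w hw0
    -- some letter `i` beyond `x` has been lowered
    have hex : ∃ y, x < y ∧ T y = i ∧ w y = j := by
      by_contra! hno
      -- Otherwise every `i` of `T` stays an `i` in `w`; equal weights then make these positions
      -- coincide, and `w = T`.
      have hsub : univ.filter (fun y => T y = i) ⊆ univ.filter (fun y => w y = i) := by
        intro y hy
        rw [mem_filter_univ] at hy ⊢
        by_cases hyx : y ≤ x
        · exact hw2 y (by simp [hZ, hyx, hy])
        · have := hno y (not_le.1 hyx) hy
          rcases hw1 y with h1 | h1
          · rw [h1]
            simp [hs, hyx, hy]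
          · exact absurd h1.2 this
      have heq := Finset.eq_of_subset_of_card_le hsub (by rw [hTw i, hww i])
      apply hwT
      funext y
      have hiff : T y = i ↔ w y = i := by
        have := Finset.ext_iff.1 heq y
        simpa using this
      have h1 := hw1 y
      simp only [hs] at h1
      split_ifs at h1 with hy
      · rcases h1 with h1 | h1
        · exact absurd ((hiff.2 h1).symm.trans hy.2) hne.symm
        · rw [h1.2, hy.2]
      · rcases h1 with h1 | h1
        · exact h1
        · rw [hiff.1 h1.1, h1.1]
    obtain ⟨y, hxy, hTy, hwy⟩ := hex
    -- Beyond `x` the word `s` agrees with `T`, and lowering replaces `i` by `i + 1`.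
    have hge : ∀ z, x < z → T z ≤ w z := by
      intro z hz
      rcases hw1 z with h1 | h1
      · rw [h1]; simp [hs, not_le.2 hz]
      · simp only [hs, not_le.2 hz, false_and, if_false] at h1
        rw [h1.1, h1.2, Fin.le_def]
        omega
    refine absurd (hmax w hw0) (not_le.2 ?_)
    -- compare at the last place of difference
    obtain ⟨z, hz, hzmax⟩ := Finset.exists_max_image (univ.filter fun z => T z ≠ w z) id
      ⟨y, by simp [hTy, hwy, hne.symm]⟩
    rw [mem_filter_univ] at hz
    have hyz : y ≤ z := hzmax y (by simp [hTy, hwy, hne.symm])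
    refine ⟨z, fun t ht => ?_, lt_of_le_of_ne (hge z (hxy.trans_le hyz)) hz⟩
    by_contra hc
    exact absurd (hzmax t ((mem_filter_univ _).2 hc)) (not_le.2 ht)
  · intro hc
    exfalso
    apply hc
    rw [mem_filter_univ]
    refine ⟨fun y => ?_, fun z hz => ?_⟩
    · simp only [hs]
      split_ifs with hy
      · exact Or.inr ⟨rfl, hy.2⟩
      · exact Or.inl rfl
    · simp only [hZ, mem_filter_univ] at hz
      exact hz.2

end Lowers

/-! ### Signed sums over label stabilizers -/

section Signed

variable {r : ℕ} {κ : Type*}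

open Classical in
/-- The permutations of the positions that preserve the labelling `γ`. -/
noncomputable def labelStab (γ : Fin r → κ) : Finset (Equiv.Perm (Fin r)) :=
  {σ | γ ∘ σ = γ}

theorem mem_labelStab {γ : Fin r → κ} {σ : Equiv.Perm (Fin r)} :
    σ ∈ labelStab γ ↔ ∀ x, γ (σ x) = γ x := by
  simp [labelStab, funext_iff]

theorem one_mem_labelStab (γ : Fin r → κ) : 1 ∈ labelStab γ := by
  simp [mem_labelStab]

theorem mul_mem_labelStab {γ : Fin r → κ} {σ τ : Equiv.Perm (Fin r)} (hσ : σ ∈ labelStab γ)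
    (hτ : τ ∈ labelStab γ) : σ * τ ∈ labelStab γ := by
  rw [mem_labelStab] at *
  intro x
  simp [hσ, hτ]

theorem inv_mem_labelStab {γ : Fin r → κ} {σ : Equiv.Perm (Fin r)} (hσ : σ ∈ labelStab γ) :
    σ⁻¹ ∈ labelStab γ := by
  rw [mem_labelStab] at *
  intro x
  simpa using (hσ (σ⁻¹ x)).symm

theorem swap_mem_labelStab {γ : Fin r → κ} {a b : Fin r} (h : γ a = γ b) :
    Equiv.swap a b ∈ labelStab γ := by
  rw [mem_labelStab]
  intro x
  classical
  by_cases hxa : x = a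
  · subst hxa; simp [h]
  · by_cases hxb : x = b
    · subst hxb; simp [h]
    · rw [Equiv.swap_apply_of_ne_of_ne hxa hxb]

variable {A : Type*} [AddCommGroup A]

theorem sum_sign_comp_mul {γ : Fin r → κ} {τ : Equiv.Perm (Fin r)} (hτ : τ ∈ labelStab γ)
    (f : Equiv.Perm (Fin r) → A) :
    ∑ σ ∈ labelStab γ, (Equiv.Perm.sign σ : ℤ) • f (τ * σ) =
      (Equiv.Perm.sign τ : ℤ) • ∑ σ ∈ labelStab γ, (Equiv.Perm.sign σ : ℤ) • f σ := by
  rw [smul_sum]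
  refine Finset.sum_bij' (fun σ _ => τ * σ) (fun σ _ => τ⁻¹ * σ)
    (fun σ hσ => mul_mem_labelStab hτ hσ)
    (fun σ hσ => mul_mem_labelStab (inv_mem_labelStab hτ) hσ) (by simp) (by simp) ?_
  intro σ _
  rw [smul_smul, Equiv.Perm.sign_mul]
  have : (Equiv.Perm.sign τ : ℤ) * (Equiv.Perm.sign τ : ℤ) = 1 := by
    rw [← Units.val_mul, Int.units_mul_self, Units.val_one]
  rw [Units.val_mul, ← mul_assoc, this, one_mul]

/-- A signed sum over a label stabilizer vanishes if the summands are invariant under right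
multiplication by a transposition of the stabilizer. -/
theorem sum_sign_eq_zero {γ : Fin r → κ} {a b : Fin r} (hab : a ≠ b) (h : γ a = γ b)
    {f : Equiv.Perm (Fin r) → A} (hf : ∀ σ ∈ labelStab γ, f (σ * Equiv.swap a b) = f σ) :
    ∑ σ ∈ labelStab γ, (Equiv.Perm.sign σ : ℤ) • f σ = 0 := by
  refine Finset.sum_involution (fun σ _ => σ * Equiv.swap a b) ?_ ?_ ?_ ?_
  · intro σ hσ
    rw [hf σ hσ, Equiv.Perm.sign_mul, Equiv.Perm.sign_swap hab]
    simp
  · intro σ _ _ hc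
    rw [mul_eq_left, Equiv.swap_eq_one_iff] at hc
    exact hab hc
  · intro σ hσ
    exact mul_mem_labelStab hσ (swap_mem_labelStab h)
  · intro σ _
    simp [mul_assoc]

/-- The left-handed version of `sum_sign_eq_zero`. -/
theorem sum_sign_eq_zero' {γ : Fin r → κ} {a b : Fin r} (hab : a ≠ b) (h : γ a = γ b)
    {f : Equiv.Perm (Fin r) → A} (hf : ∀ σ ∈ labelStab γ, f (Equiv.swap a b * σ) = f σ) :
    ∑ σ ∈ labelStab γ, (Equiv.Perm.sign σ : ℤ) • f σ = 0 := by
  refine Finset.sum_involution (fun σ _ => Equiv.swap a b * σ) ?_ ?_ ?_ ?_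
  · intro σ hσ
    rw [hf σ hσ, Equiv.Perm.sign_mul, Equiv.Perm.sign_swap hab]
    simp
  · intro σ _ _ hc
    rw [mul_eq_right, Equiv.swap_eq_one_iff] at hc
    exact hab hc
  · intro σ hσ
    exact mul_mem_labelStab (swap_mem_labelStab h) hσ
  · intro σ _
    simp [← mul_assoc]

end Signed

/-! ## Polytabloids -/

section Polytabloid

variable {m r : ℕ} (K : Type*) [Field K] (lam : Parts m r)

open Classical in
/-- The polytabloid of the bijective tableau `β⁻¹`: the signed sum of the words
`row ∘ σ ∘ β` over the column stabilizer. -/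
noncomputable def polytabloid (β : Equiv.Perm (Fin r)) : (Fin r → Fin m) → K :=
  ∑ σ ∈ labelStab lam.col, (Equiv.Perm.sign σ : ℤ) • Pi.single (lam.row ∘ σ ∘ β) (1 : K)

variable {K lam}

theorem polytabloid_apply (β : Equiv.Perm (Fin r)) (w : Fin r → Fin m) :
    polytabloid K lam β w = ∑ σ ∈ labelStab lam.col,
      (Equiv.Perm.sign σ : ℤ) • (if w = lam.row ∘ σ ∘ β then (1 : K) else 0) := by
  classical
  simp [polytabloid, Finset.sum_apply, Pi.single_apply]

theorem exists_of_polytabloid_ne_zero {β : Equiv.Perm (Fin r)} {w : Fin r → Fin m}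
    (h : polytabloid K lam β w ≠ 0) : ∃ σ ∈ labelStab lam.col, w = lam.row ∘ σ ∘ β := by
  rw [polytabloid_apply] at h
  obtain ⟨σ, hσ, h1⟩ := Finset.exists_ne_zero_of_sum_ne_zero h
  refine ⟨σ, hσ, ?_⟩
  by_contra hc
  simp [hc] at h1

/-- A permutation preserving both rows and columns is trivial, so only the identity contributes. -/
theorem polytabloid_apply_self (β : Equiv.Perm (Fin r)) :
    polytabloid K lam β (lam.row ∘ β) = 1 := by
  rw [polytabloid_apply, Finset.sum_eq_single 1]
  · simp
  · intro σ hσ h1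
    rw [if_neg, smul_zero]
    intro hc
    apply h1
    ext x : 1
    refine lam.box_ext ?_ (mem_labelStab.1 hσ x)
    simpa using (congrFun hc (β⁻¹ x)).symm
  · intro h
    exact absurd (one_mem_labelStab _) h

/-- If some term contributes, all letters `i` of `s` sit in the first `λ_i` columns. There are more
than `λ_i` of them, so two share a column; transposing these fixes `s`, and the terms cancel in
pairs. -/
theorem polytabloid_mem_kernelIntersection (β : Equiv.Perm (Fin r)) :
    polytabloid K lam β ∈ kernelIntersection K lam := by
  classical
  refine ⟨fun w hw => ?_, fun i j s hij hs => ?_⟩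
  · obtain ⟨σ, -, rfl⟩ := exists_of_polytabloid_ne_zero hw
    exact hasWeight_row_comp lam (σ * β)
  · have e : ∑ w with Lowers i j s w, polytabloid K lam β w = ∑ σ ∈ labelStab lam.col,
        (Equiv.Perm.sign σ : ℤ) • (if Lowers i j s (lam.row ∘ σ ∘ β) then (1 : K) else 0) := by
      simp only [polytabloid_apply]
      rw [Finset.sum_comm]
      refine Finset.sum_congr rfl fun σ _ => ?_
      rw [← Finset.smul_sum, Finset.sum_ite_eq']
      simp
    rw [e]
    by_cases hno : ∀ σ ∈ labelStab lam.col, ¬ Lowers i j s (lam.row ∘ σ ∘ β)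
    · refine Finset.sum_eq_zero fun σ hσ => ?_
      simp [hno σ hσ]
    push Not at hno
    obtain ⟨σ₀, hσ₀, hlow⟩ := hno
    have hle : lam.part j ≤ lam.part i := lam.anti (by rw [Fin.le_def]; omega)
    obtain ⟨x, hx, y, hy, hxy, hcol⟩ := Finset.exists_ne_map_eq_of_card_lt_of_maps_to
      (s := univ.filter fun x => s x = i) (t := Finset.range (lam.part i))
      (f := fun x => lam.col (β x)) (by simpa using hs) (by
        intro x hx
        simp only [coe_filter_univ, Set.mem_ofPred_eq] at hx
        simp only [coe_range, Set.mem_Iio]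
        rw [← mem_labelStab.1 hσ₀ (β x)]
        refine (lam.col_lt _).trans_le ?_
        rcases hlow x with h | h
        · rw [show lam.row (σ₀ (β x)) = i from h.trans hx]
        · rw [show lam.row (σ₀ (β x)) = j from h.2]
          exact hle)
    rw [mem_filter_univ] at hx hy
    refine sum_sign_eq_zero (a := β x) (b := β y) (by simpa using hxy) hcol fun σ _ => ?_
    congr 1
    have e1 : lam.row ∘ (σ * Equiv.swap (β x) (β y) : Equiv.Perm (Fin r)) ∘ β =
        (lam.row ∘ σ ∘ β) ∘ Equiv.swap x y := by
      funext z
      simp only [Function.comp_apply, Equiv.Perm.mul_apply]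
      rw [β.injective.swap_apply]
    have e2 : s ∘ Equiv.swap x y = s := by
      funext z
      exact mem_labelStab.1 (swap_mem_labelStab (hx.trans hy.symm)) z
    rw [e1, eq_iff_iff]
    conv_lhs => rw [← e2]
    exact lowers_comp_iff _

/-- For a ballot word `T`, the tableau placing the `c`-th letter `i` of `T` in the box `(i, c)`. -/
theorem exists_standard {T : Fin r → Fin m} (hw : HasWeight lam T) (hb : IsBallot T) :
    ∃ β : Equiv.Perm (Fin r), lam.row ∘ β = T ∧
      ∀ x y, lam.col (β x) = lam.col (β y) → T x < T y → x < y := by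
  classical
  have hlt : ∀ x, #{y | y < x ∧ T y = T x} < lam.part (T x) := by
    intro x
    rw [← hw (T x)]
    refine Finset.card_lt_card (Finset.ssubset_iff_of_subset ?_ |>.2 ⟨x, by simp, by simp⟩)
    intro y
    simp only [mem_filter_univ]
    exact fun h => h.2
  set f : Fin r → Fin r := fun x => lam.boxEquiv ⟨T x, ⟨_, hlt x⟩⟩ with hf
  have hrow : ∀ x, lam.row (f x) = T x := fun x => lam.row_boxEquiv _
  have hcol : ∀ x, lam.col (f x) = #{y | y < x ∧ T y = T x} := fun x => lam.col_boxEquiv _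
  have hinj : Function.Injective f := by
    have key : ∀ x y, T x = T y → x < y →
        #{z | z < x ∧ T z = T x} < #{z | z < y ∧ T z = T y} := by
      intro x y hT hxy
      refine Finset.card_lt_card (Finset.ssubset_iff_of_subset ?_ |>.2 ⟨x, by simp [hxy, hT], by simp⟩)
      intro z
      simp only [mem_filter_univ]
      exact fun h => ⟨h.1.trans hxy, h.2.trans hT⟩
    intro x y h
    have h1 : T x = T y := by rw [← hrow, ← hrow, h]
    have h2 : #{z | z < x ∧ T z = T x} = #{z | z < y ∧ T z = T y} := by rw [← hcol, ← hcol, h]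
    rcases lt_trichotomy x y with hxy | hxy | hxy
    · exact absurd h2 (key x y h1 hxy).ne
    · exact hxy
    · exact absurd h2 (key y x h1.symm hxy).ne'
  refine ⟨Equiv.ofBijective f (Finite.injective_iff_bijective.1 hinj), funext hrow, ?_⟩
  intro x y hc hT
  simp only [Equiv.ofBijective_apply, hcol] at hc
  by_contra! hyx
  have hne : y ≠ x := by
    rintro rfl
    exact hT.ne rfl
  -- Were `y < x`, the ballot condition at `y` would put `x` in a column strictly to the right of
  -- that of `y`.
  have h1 := hb (T x) (T y) y hT.le
  have h2 : #{z | z ≤ y ∧ T z = T x} ≤ #{z | z < x ∧ T z = T x} := by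
    refine Finset.card_le_card fun z => ?_
    simp only [mem_filter_univ]
    exact fun h => ⟨h.1.trans_lt (lt_of_le_of_ne hyx hne), h.2⟩
  have h3 : #{z | z < y ∧ T z = T y} < #{z | z ≤ y ∧ T z = T y} := by
    refine Finset.card_lt_card (Finset.ssubset_iff_of_subset ?_ |>.2 ⟨y, by simp, by simp⟩)
    intro z
    simp only [mem_filter_univ]
    exact fun h => ⟨h.1.le, h.2⟩
  omega

/-- Let `x` be the last position where the words differ. If the letter grew there, `σ` would send
the box of `x` down its column to the box of some `y`, and `y > x` by standardness. By the choice of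
`x`, `σ` fixes the box of `y`, contradicting injectivity. -/
theorem polytabloid_le {β : Equiv.Perm (Fin r)}
    (hβ : ∀ x y, lam.col (β x) = lam.col (β y) → lam.row (β x) < lam.row (β y) → x < y)
    {w : Fin r → Fin m} (hw : polytabloid K lam β w ≠ 0) :
    toColex w ≤ toColex (lam.row ∘ β) := by
  classical
  obtain ⟨σ, hσ, rfl⟩ := exists_of_polytabloid_ne_zero hw
  rw [mem_labelStab] at hσ
  by_cases heq : lam.row ∘ σ ∘ β = lam.row ∘ β
  · rw [heq]
  obtain ⟨x₀, hx₀⟩ := Function.ne_iff.1 heq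
  obtain ⟨x, hx, hmax⟩ := Finset.exists_max_image
    (univ.filter fun z => lam.row (σ (β z)) ≠ lam.row (β z)) id ⟨x₀, by simpa using hx₀⟩
  rw [mem_filter_univ] at hx
  refine le_of_lt ⟨x, fun t ht => ?_, ?_⟩
  · by_contra hc
    exact absurd (hmax t (by simpa using hc)) (not_le.2 ht)
  · refine lt_of_le_of_ne (not_lt.1 fun hlt => ?_) hx
    set y := β⁻¹ (σ (β x)) with hy
    have hβy : β y = σ (β x) := by simp [hy]
    have hxy : x < y := by
      refine hβ x y ?_ ?_
      · rw [hβy, hσ]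
      · rw [hβy]
        exact hlt
    have hfix : lam.row (σ (β y)) = lam.row (β y) := by
      by_contra hc
      exact absurd (hmax y (by simpa using hc)) (not_le.2 hxy)
    have h1 : σ (β y) = β y := lam.box_ext hfix (hσ _)
    rw [hβy] at h1
    exact hx (congrArg lam.row (σ.injective h1))

variable (K lam)

/-- One inclusion of James' kernel intersection theorem. -/
theorem kernelIntersection_le_span :
    kernelIntersection K lam ≤ Submodule.span K (Set.range (polytabloid K lam)) := by
  classical
  -- Induction on the leading word: it is a ballot word, so subtracting a multiple of the standard
  -- polytabloid with the same leading word produces a smaller one.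
  have main : ∀ T : Colex (Fin r → Fin m), ∀ h ∈ kernelIntersection K lam, h (ofColex T) ≠ 0 →
      (∀ w, h w ≠ 0 → toColex w ≤ T) → h ∈ Submodule.span K (Set.range (polytabloid K lam)) := by
    intro T
    induction T using WellFoundedLT.induction with
    | ind T ih =>
      intro h hh hT hmax
      obtain ⟨β, hβ, hβ'⟩ := exists_standard (hh.1 _ hT) (isBallot_of_maximal hh hT hmax)
      have hstd : ∀ x y, lam.col (β x) = lam.col (β y) → lam.row (β x) < lam.row (β y) → x < y := by
        intro x y h1 h2
        rw [← hβ] at hβ'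
        exact hβ' x y h1 h2
      set g := h - h (ofColex T) • polytabloid K lam β with hg
      have hgT : g (ofColex T) = 0 := by
        have := polytabloid_apply_self (K := K) (lam := lam) β
        rw [hβ] at this
        simp [hg, this]
      have hgk : g ∈ kernelIntersection K lam :=
        Submodule.sub_mem _ hh (Submodule.smul_mem _ _ (polytabloid_mem_kernelIntersection β))
      have hgle : ∀ w, g w ≠ 0 → toColex w < T := by
        intro w hw
        refine lt_of_le_of_ne ?_ ?_
        · by_contra hc
          apply hw
          have h1 : h w = 0 := by
            by_contra h1
            exact hc (hmax w h1)
          have h2 : polytabloid K lam β w = 0 := by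
            by_contra h2
            have := polytabloid_le hstd h2
            rw [hβ] at this
            exact hc this
          simp [hg, h1, h2]
        · rintro rfl
          exact hw hgT
      have hgs : g ∈ Submodule.span K (Set.range (polytabloid K lam)) := by
        by_cases hg0 : g = 0
        · rw [hg0]
          exact Submodule.zero_mem _
        obtain ⟨w₀, hw₀⟩ := Function.ne_iff.1 hg0
        obtain ⟨w, hw, hwm⟩ := Finset.exists_max_image (univ.filter fun w => g w ≠ 0) toColex
          ⟨w₀, by simpa using hw₀⟩
        rw [mem_filter_univ] at hw
        exact ih (toColex w) (hgle w hw) g hgk hw fun w' hw' => hwm w' (by simpa using hw')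
      have : h = g + h (ofColex T) • polytabloid K lam β := by simp [hg]
      rw [this]
      exact Submodule.add_mem _ hgs (Submodule.smul_mem _ _ (Submodule.subset_span ⟨β, rfl⟩))
  intro h hh
  by_cases h0 : h = 0
  · rw [h0]
    exact Submodule.zero_mem _
  obtain ⟨w₀, hw₀⟩ := Function.ne_iff.1 h0
  obtain ⟨w, hw, hwm⟩ := Finset.exists_max_image (univ.filter fun w => h w ≠ 0) toColex
    ⟨w₀, by simpa using hw₀⟩
  rw [mem_filter_univ] at hw
  exact main (toColex w) h hh hw fun w' hw' => hwm w' (by simpa using hw')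

end Polytabloid

/-! ### Counting lowerings of prescribed weight -/

section Counting

variable {m r : ℕ}

/-- A lowering that fixes `Z` is determined by the set of letters `i` outside `Z` that survive, and
this set is arbitrary. -/
theorem card_lowers_fixing {i j : Fin m} (hij : i ≠ j) {s : Fin r → Fin m} {Z : Finset (Fin r)}
    (N : ℕ) :
    #{w | Lowers i j s w ∧ (∀ z ∈ Z, w z = i) ∧ #{x | w x = i ∧ x ∉ Z} = N ∧ ∀ z ∈ Z, s z = i} =
      if ∀ z ∈ Z, s z = i then (#{x | s x = i ∧ x ∉ Z}).choose N else 0 := by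
  split_ifs with hZ
  · rw [← card_powersetCard]
    refine Finset.card_bij (fun w _ => univ.filter fun x => w x = i ∧ x ∉ Z) ?_ ?_ ?_
    · intro w hw
      rw [mem_filter_univ] at hw
      rw [mem_powersetCard]
      refine ⟨fun x => ?_, hw.2.2.1⟩
      simp only [mem_filter_univ]
      rintro ⟨h1, h2⟩
      rcases hw.1 x with h | h
      · exact ⟨h ▸ h1, h2⟩
      · exact ⟨h.1, h2⟩
    · intro w hw w' hw' heq
      rw [mem_filter_univ] at hw hw'
      funext x
      have h0 := Finset.ext_iff.1 heq x
      simp only [mem_filter_univ] at h0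
      by_cases hx : x ∈ Z
      · rw [hw.2.1 x hx, hw'.2.1 x hx]
      · simp only [hx, not_false_eq_true, and_true] at h0
        rcases hw.1 x with h | h <;> rcases hw'.1 x with h' | h'
        · rw [h, h']
        · rw [h, h'.1] at h0
          exact absurd ((h0.1 rfl).symm.trans h'.2) hij
        · rw [h', h.1] at h0
          exact absurd ((h0.2 rfl).symm.trans h.2) hij
        · rw [h.2, h'.2]
    · intro A hA
      rw [mem_powersetCard] at hA
      have hA' : ∀ x ∈ A, s x = i ∧ x ∉ Z := fun x hx => by simpa using hA.1 hx
      set w : Fin r → Fin m := fun x => if s x = i ∧ x ∉ A ∧ x ∉ Z then j else s x with hw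
      have hfil : (univ.filter fun x => w x = i ∧ x ∉ Z) = A := by
        ext x
        simp only [mem_filter_univ, hw]
        constructor
        · rintro ⟨h1, h2⟩
          split_ifs at h1 with h
          · exact absurd h1.symm hij
          · by_contra hc
            exact h ⟨h1, hc, h2⟩
        · intro hx
          rw [if_neg (by tauto)]
          exact hA' x hx
      refine ⟨w, ?_, hfil⟩
      rw [mem_filter_univ]
      refine ⟨fun x => ?_, fun z hz => ?_, by rw [hfil]; exact hA.2, hZ⟩
      · simp only [hw]
        split_ifs with h
        · exact Or.inr ⟨h.1, rfl⟩
        · exact Or.inl rfl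
      · simp only [hw]
        rw [if_neg (by tauto), hZ z hz]
  · rw [card_eq_zero, filter_eq_empty_iff]
    tauto

theorem card_add_card_of_lowers {i j : Fin m} (hij : i ≠ j) {s w : Fin r → Fin m}
    (h : Lowers i j s w) :
    #{x | w x = i} + #{x | w x = j} = #{x | s x = i} + #{x | s x = j} := by
  have key : ∀ v : Fin r → Fin m, #{x | v x = i} + #{x | v x = j} = #{x | v x = i ∨ v x = j} := by
    intro v
    rw [filter_or, card_union_of_disjoint]
    rw [disjoint_filter]
    intro x _ h1 h2
    exact hij (h1.symm.trans h2)
  rw [key, key]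
  congr 1
  ext x
  simp only [mem_filter_univ]
  rcases h x with h | h
  · rw [h]
  · simp [h.1, h.2]

theorem eq_iff_of_lowers {i j k : Fin m} {s w : Fin r → Fin m} (h : Lowers i j s w) (hi : k ≠ i)
    (hj : k ≠ j) (x : Fin r) : w x = k ↔ s x = k := by
  rcases h x with h | h
  · rw [h]
  · rw [h.1, h.2]
    simp [hi.symm, hj.symm]

/-- Lowering preserves the joint number of `i` and `j` and all other counts. Once one lowering has
weight λ, only the number of `i` remains to be checked. -/
theorem hasWeight_iff_of_lowers {lam : Parts m r} {i j : Fin m} (hij : i ≠ j)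
    {s w w₀ : Fin r → Fin m} (h : Lowers i j s w) (h₀ : Lowers i j s w₀) (hw₀ : HasWeight lam w₀) :
    HasWeight lam w ↔ #{x | w x = i} = lam.part i := by
  refine ⟨fun hw => hw i, fun hi k => ?_⟩
  by_cases hki : k = i
  · rw [hki, hi]
  by_cases hkj : k = j
  · have h1 := card_add_card_of_lowers hij h
    have h2 := card_add_card_of_lowers hij h₀
    rw [hw₀ i, hw₀ j] at h2
    rw [hkj]
    omega
  · rw [← hw₀ k]
    simp only [eq_iff_of_lowers h hki hkj, eq_iff_of_lowers h₀ hki hkj]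

theorem card_le_of_lowers {lam : Parts m r} {i j : Fin m} (hij : i ≠ j)
    {s w : Fin r → Fin m} (h : Lowers i j s w) (hw : HasWeight lam w) :
    #{x | s x = i} ≤ lam.part i + lam.part j := by
  have h1 := card_add_card_of_lowers hij h
  rw [hw i, hw j] at h1
  omega

end Counting

/-! ## The alternating function attached to the sum of the standard tableaux -/

section Alternation

variable {m r : ℕ} (K : Type*) [Field K] (lam : Parts m r) (mu : Parts 2 r) (o : Fin m)

/-- The words of weight `λ` without the first letter in the second row of `μ`. -/
def IsRowWord (w : Fin r → Fin m) : Prop :=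
  HasWeight lam w ∧ ∀ b, mu.row b = 1 → w b ≠ o

open Classical in
/-- The indicator function of `IsRowWord`. -/
noncomputable def rowWordFun (w : Fin r → Fin m) : K := if IsRowWord lam mu o w then 1 else 0

variable {K} in
/-- The signed sum of the translates of a function on words under a label stabilizer. -/
noncomputable def alternation {κ : Type*} (γ : Fin r → κ) (h : (Fin r → Fin m) → K)
    (w : Fin r → Fin m) : K :=
  ∑ σ ∈ labelStab γ, (Equiv.Perm.sign σ : ℤ) • h (w ∘ σ)

variable {K lam mu o}

theorem alternation_comp_swap {κ : Type*} {γ : Fin r → κ} (h : (Fin r → Fin m) → K) {a b : Fin r}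
    (hab : a ≠ b) (hγ : γ a = γ b) (w : Fin r → Fin m) :
    alternation γ h (w ∘ Equiv.swap a b) = - alternation γ h w := by
  have := sum_sign_comp_mul (swap_mem_labelStab hγ) (fun σ => h (w ∘ σ))
  rw [Equiv.Perm.sign_swap hab] at this
  simpa [alternation, Function.comp_assoc, Equiv.Perm.coe_mul] using this

/-- Being a row word depends only on the weight and the positions of `o`. The two letters therefore
need not be equal: if both or neither are `o`, their transposition pairs off the summands. -/
theorem alternation_eq_zero {a b : Fin r} (hab : a ≠ b) (hcol : mu.col a = mu.col b)
    {w : Fin r → Fin m} (hw : w a = o ↔ w b = o) :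
    alternation mu.col (rowWordFun K lam mu o) w = 0 := by
  refine sum_sign_eq_zero' hab hcol fun σ _ => ?_
  have hz : ∀ x, w (Equiv.swap a b x) = o ↔ w x = o := by
    intro x
    by_cases hxa : x = a
    · subst hxa; simp [hw]
    · by_cases hxb : x = b
      · subst hxb; simp [hw]
      · rw [Equiv.swap_apply_of_ne_of_ne hxa hxb]
  have hiff : IsRowWord lam mu o (w ∘ (Equiv.swap a b * σ : Equiv.Perm (Fin r))) ↔
      IsRowWord lam mu o (w ∘ σ) :=
    and_congr ((hasWeight_comp_iff _).trans (hasWeight_comp_iff _).symm)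
      (forall_congr' fun x => by simp [hz])
  unfold rowWordFun
  by_cases h : IsRowWord lam mu o (w ∘ σ)
  · rw [if_pos (hiff.2 h), if_pos h]
  · rw [if_neg (mt hiff.1 h), if_neg h]

theorem alternation_ne_zero {w : Fin r → Fin m}
    (hw : alternation mu.col (rowWordFun K lam mu o) w ≠ 0) : HasWeight lam w := by
  obtain ⟨σ, -, h⟩ := Finset.exists_ne_zero_of_sum_ne_zero hw
  by_contra hc
  apply h
  rw [rowWordFun, if_neg, smul_zero]
  rintro ⟨h1, -⟩
  exact hc ((hasWeight_comp_iff σ).1 h1)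

theorem Parts.exists_partner {b : Fin r} (hb : mu.row b = 1) :
    ∃ a, mu.row a = 0 ∧ mu.col a = mu.col b ∧ a ≠ b := by
  have h1 := mu.col_lt b
  rw [hb] at h1
  obtain ⟨a, ha, ha'⟩ := mu.exists_box (h1.trans_le (mu.anti (Fin.zero_le 1)))
  refine ⟨a, ha, ha', ?_⟩
  rintro rfl
  simp [ha] at hb

theorem Parts.exists_partner' {a : Fin r} (ha : mu.col a < mu.part 1) (ha0 : mu.row a = 0) :
    ∃ b, mu.row b = 1 ∧ mu.col a = mu.col b ∧ a ≠ b := by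
  obtain ⟨b, hb, hb'⟩ := mu.exists_box ha
  refine ⟨b, hb, hb'.symm, ?_⟩
  rintro rfl
  simp [ha0] at hb

/-- A nontrivial column permutation brings an `o` from the top of some two-box column into the
second row, so only the identity contributes. -/
theorem alternation_eq_one {w : Fin r → Fin m} (hw : IsRowWord lam mu o w)
    (htop : ∀ a, mu.row a = 0 → mu.col a < mu.part 1 → w a = o) :
    alternation mu.col (rowWordFun K lam mu o) w = 1 := by
  rw [alternation, Finset.sum_eq_single 1]
  · simp [rowWordFun, hw]
  · intro σ hσ h1
    rw [mem_labelStab] at hσ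
    have hbot : ∀ b, mu.row b = 1 → σ b ≠ b → ¬ IsRowWord lam mu o (w ∘ σ) := by
      rintro b hb hne ⟨-, h2⟩
      refine h2 b hb (htop (σ b) ?_ ?_)
      · have : mu.row (σ b) ≠ 1 := fun h => hne (mu.box_ext (h.trans hb.symm) (hσ b))
        omega
      · rw [hσ, ← hb]
        exact mu.col_lt b
    have hex : ∃ b, mu.row b = 1 ∧ σ b ≠ b := by
      obtain ⟨x, hx⟩ : ∃ x, σ x ≠ x := by
        by_contra! hc
        exact h1 (Equiv.ext hc)
      by_cases hrow : mu.row x = 1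
      · exact ⟨x, hrow, hx⟩
      · refine ⟨σ x, ?_, fun h => hx (σ.injective h)⟩
        have : mu.row (σ x) ≠ mu.row x := fun h => hx (mu.box_ext h (hσ x))
        omega
    obtain ⟨b, hb, hne⟩ := hex
    rw [rowWordFun, if_neg (hbot b hb hne), smul_zero]
  · intro h
    exact absurd (one_mem_labelStab _) h

/-- Lowering `i` to `j` does not move any `o`, so if any row word occurs the sum counts the choices
of `λ_i` surviving letters among `λ_i + t`. Here `t ≤ λ_j`, because all the excess letters become
`j`. -/
theorem sum_lowers_rowWordFun {i j : Fin m} (hij : (i : ℕ) + 1 = j) (hi : i ≠ o) (hj : j ≠ o)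
    (hR : ∀ t, 1 ≤ t → t ≤ lam.part j → ((lam.part i + t).choose t : K) = 0)
    {s : Fin r → Fin m} (hs : lam.part i < #{x | s x = i}) :
    ∑ w with Lowers i j s w, rowWordFun K lam mu o w = 0 := by
  classical
  have hne : i ≠ j := by
    rintro rfl
    omega
  by_cases hno : ∀ w, Lowers i j s w → ¬ IsRowWord lam mu o w
  · refine Finset.sum_eq_zero fun w hw => ?_
    rw [rowWordFun, if_neg (hno w (by simpa using hw))]
  push Not at hno
  obtain ⟨w₀, h₀, hw₀⟩ := hno
  have h1 := card_lowers_fixing hne (s := s) (Z := ∅) (lam.part i)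
  simp only [notMem_empty, IsEmpty.forall_iff, implies_true, not_false_eq_true, and_true, true_and,
    if_true] at h1
  simp only [rowWordFun]
  rw [Finset.sum_boole, filter_filter]
  have e : univ.filter (fun w => Lowers i j s w ∧ IsRowWord lam mu o w) =
      univ.filter (fun w => Lowers i j s w ∧ #{x | w x = i} = lam.part i) := by
    ext w
    simp only [mem_filter_univ]
    refine and_congr_right fun h => ?_
    rw [← hasWeight_iff_of_lowers hne h h₀ hw₀.1]
    refine ⟨fun h => h.1, fun hw => ⟨hw, fun b hb => ?_⟩⟩
    have h2 := hw₀.2 b hb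
    rw [ne_eq, eq_iff_of_lowers h₀ hi.symm hj.symm] at h2
    rwa [ne_eq, eq_iff_of_lowers h hi.symm hj.symm]
  rw [e, h1]
  have h2 := card_le_of_lowers hne h₀ hw₀.1
  obtain ⟨t, ht⟩ := Nat.exists_eq_add_of_lt hs
  have h3 := hR (t + 1) (by omega) (by omega)
  rw [ht, ← Nat.choose_symm_add] at *
  exact h3

/-- Each `o` on top of a two-box column must survive, since otherwise the column has no `o` and the
alternation vanishes. The sum thus counts choices of `λ_o - μ_2` survivors among the other `λ_o -
μ_2 + t` letters `o`. As all `o` of `s` lie in the first row, `t ≤ μ_1 - λ_o`. -/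
theorem sum_lowers_alternation_of_bot {j : Fin m} (ho : (o : ℕ) + 1 = j)
    (h1 : mu.part 1 ≤ lam.part o)
    (hR : ∀ t, 1 ≤ t → t ≤ lam.part j → t ≤ mu.part 0 - lam.part o →
      ((lam.part o - mu.part 1 + t).choose t : K) = 0)
    {s : Fin r → Fin m} (hs : lam.part o < #{x | s x = o})
    (hbot : ∀ b, mu.row b = 1 → s b ≠ o)
    (htop : ∀ a, mu.row a = 0 → mu.col a < mu.part 1 → s a = o) :
    ∑ w with Lowers o j s w, alternation mu.col (rowWordFun K lam mu o) w = 0 := by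
  classical
  have hne : o ≠ j := by
    rintro rfl
    omega
  have hbot' : ∀ w, Lowers o j s w → ∀ b, mu.row b = 1 → w b ≠ o := by
    intro w hw b hb
    rcases hw b with h | h
    · rw [h]; exact hbot b hb
    · exact absurd h.1 (hbot b hb)
  -- The tops of the two-box columns, matched with the boxes of the second row.
  set Z : Finset (Fin r) := {a | mu.row a = 0 ∧ mu.col a < mu.part 1} with hZ
  have hZcard : #Z = mu.part 1 := by
    rw [← hasWeight_row mu 1]
    symm
    refine Finset.card_bij (fun b hb => (mu.exists_partner (Finset.mem_filter.1 hb).2).choose)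
      ?_ ?_ ?_
    · intro b hb
      have hs := (mu.exists_partner (Finset.mem_filter.1 hb).2).choose_spec
      rw [mem_filter_univ] at hb
      simp only [hZ, mem_filter_univ]
      refine ⟨hs.1, ?_⟩
      rw [hs.2.1, ← hb]
      exact mu.col_lt b
    · intro b hb b' hb' h
      have hs := (mu.exists_partner (Finset.mem_filter.1 hb).2).choose_spec
      have hs' := (mu.exists_partner (Finset.mem_filter.1 hb').2).choose_spec
      rw [mem_filter_univ] at hb hb'
      refine mu.box_ext (hb.trans hb'.symm) ?_
      rw [← hs.2.1, ← hs'.2.1, h]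
    · intro a ha
      simp only [hZ, mem_filter_univ] at ha
      obtain ⟨b, hb, hab, -⟩ := mu.exists_partner' ha.2 ha.1
      refine ⟨b, by simpa using hb, ?_⟩
      have hs := (mu.exists_partner hb).choose_spec
      exact mu.box_ext (hs.1.trans ha.1.symm) (hs.2.1.trans hab.symm)
  have hZs : ∀ z ∈ Z, s z = o := fun z hz => by
    simp only [hZ, mem_filter_univ] at hz
    exact htop z hz.1 hz.2
  have hval : ∀ w, Lowers o j s w → alternation mu.col (rowWordFun K lam mu o) w =
      if (∀ z ∈ Z, w z = o) ∧ HasWeight lam w then 1 else 0 := by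
    intro w hw
    split_ifs with h
    · refine alternation_eq_one ⟨h.2, hbot' w hw⟩ fun a ha ha' => h.1 a ?_
      simp only [hZ, mem_filter_univ]
      exact ⟨ha, ha'⟩
    · by_contra hc
      apply h
      refine ⟨fun z hz => ?_, alternation_ne_zero hc⟩
      simp only [hZ, mem_filter_univ] at hz
      by_contra hzo
      obtain ⟨b, hb, hzb, hne'⟩ := mu.exists_partner' hz.2 hz.1
      exact hc (alternation_eq_zero hne' hzb (by simp [hzo, hbot' w hw b hb]))
  rw [Finset.sum_congr rfl (fun w hw => hval w ((mem_filter_univ _).1 hw)), Finset.sum_boole,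
    filter_filter]
  by_cases hno : ∀ w, Lowers o j s w → ¬ HasWeight lam w
  · rw [filter_eq_empty_iff.2]
    · simp
    · rintro w - ⟨hw1, -, hw2⟩
      exact hno w hw1 hw2
  push Not at hno
  obtain ⟨w₀, h₀, hw₀⟩ := hno
  have hsplit : ∀ w : Fin r → Fin m, (∀ z ∈ Z, w z = o) →
      #{x | w x = o} = #{x | w x = o ∧ x ∉ Z} + mu.part 1 := by
    intro w hw
    rw [← hZcard, ← card_union_of_disjoint]
    · congr 1
      ext x
      simp only [mem_filter_univ, mem_union]
      constructor
      · intro h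
        by_cases hx : x ∈ Z
        · exact Or.inr hx
        · exact Or.inl ⟨h, hx⟩
      · rintro (h | h)
        · exact h.1
        · exact hw x h
    · rw [disjoint_left]
      intro x hx
      exact ((mem_filter_univ _).1 hx).2
  have e : univ.filter (fun w => Lowers o j s w ∧ (∀ z ∈ Z, w z = o) ∧ HasWeight lam w) =
      univ.filter (fun w => Lowers o j s w ∧ (∀ z ∈ Z, w z = o) ∧
        #{x | w x = o ∧ x ∉ Z} = lam.part o - mu.part 1 ∧ ∀ z ∈ Z, s z = o) := by
    ext w
    simp only [mem_filter_univ]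
    refine and_congr_right fun h => and_congr_right fun hz => ?_
    rw [hasWeight_iff_of_lowers hne h h₀ hw₀, hsplit w hz]
    constructor
    · intro h
      exact ⟨by omega, hZs⟩
    · intro h
      omega
  rw [e, card_lowers_fixing hne, if_pos hZs]
  have h2 := card_le_of_lowers hne h₀ hw₀
  have h3 := hsplit s hZs
  have h4 : #{x | s x = o} ≤ mu.part 0 := by
    rw [← hasWeight_row mu 0]
    refine Finset.card_le_card fun x => ?_
    simp only [mem_filter_univ]
    intro hx
    have : mu.row x ≠ 1 := fun h => hbot x h hx
    omega
  obtain ⟨t, ht⟩ := Nat.exists_eq_add_of_lt hs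
  have h5 := hR (t + 1) (by omega) (by omega) (by omega)
  rw [← Nat.choose_symm_add] at h5
  convert h5 using 3
  omega

/-- Column transpositions only change signs, so the letters `o` of `s` can be moved up to the first
row one by one; `N` counts those still in the second row. -/
theorem sum_lowers_alternation {j : Fin m} (ho : (o : ℕ) + 1 = j)
    (h1 : mu.part 1 ≤ lam.part o)
    (hR : ∀ t, 1 ≤ t → t ≤ lam.part j → t ≤ mu.part 0 - lam.part o →
      ((lam.part o - mu.part 1 + t).choose t : K) = 0) (N : ℕ) :
    ∀ s : Fin r → Fin m, #{b | mu.row b = 1 ∧ s b = o} = N → lam.part o < #{x | s x = o} →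
      ∑ w with Lowers o j s w, alternation mu.col (rowWordFun K lam mu o) w = 0 := by
  classical
  have hne : o ≠ j := by
    rintro rfl
    omega
  induction N with
  | zero =>
    intro s hN hs
    rw [card_eq_zero, filter_eq_empty_iff] at hN
    have hbot : ∀ b, mu.row b = 1 → s b ≠ o := fun b hb hc => hN (mem_univ b) ⟨hb, hc⟩
    by_cases htop : ∀ a, mu.row a = 0 → mu.col a < mu.part 1 → s a = o
    · exact sum_lowers_alternation_of_bot ho h1 hR hs hbot htop
    · push Not at htop
      obtain ⟨a, ha, ha', hsa⟩ := htop
      obtain ⟨b, hb, hab, hne'⟩ := mu.exists_partner' ha' ha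
      refine Finset.sum_eq_zero fun w hw => alternation_eq_zero hne' hab ?_
      rw [mem_filter_univ] at hw
      have key : ∀ x, s x ≠ o → w x ≠ o := by
        intro x hx
        rcases hw x with h | h
        · rwa [h]
        · exact absurd h.1 hx
      simp [key a hsa, key b (hbot b hb)]
  | succ N ih =>
    intro s hN hs
    obtain ⟨b, hb⟩ : (univ.filter fun b => mu.row b = 1 ∧ s b = o).Nonempty := by
      rw [← card_pos]
      omega
    rw [mem_filter_univ] at hb
    obtain ⟨a, ha, hab, hne'⟩ := mu.exists_partner hb.1
    by_cases hsa : s a = o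
    · have hsw : s ∘ Equiv.swap a b = s := by
        funext x
        exact mem_labelStab.1 (swap_mem_labelStab (hsa.trans hb.2.symm)) x
      -- A column with two `o` in `s`: the transposition permutes the lowerings and changes signs.
      -- Words it fixes have alternation zero, so characteristic 2 is covered.
      refine Finset.sum_involution (fun w _ => w ∘ Equiv.swap a b) ?_ ?_ ?_ ?_
      · intro w _
        rw [alternation_comp_swap _ hne' hab, add_neg_cancel]
      · intro w _ h0 hc
        apply h0
        refine alternation_eq_zero hne' hab ?_
        have := congrFun hc a
        simp only [Function.comp_apply, Equiv.swap_apply_left] at this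
        rw [this]
      · intro w hw
        rw [mem_filter_univ] at hw ⊢
        rw [← hsw]
        exact (lowers_comp_iff _).2 hw
      · intro w _
        funext x
        simp
    · have h2 := ih (s ∘ Equiv.swap a b) ?_ ?_
      · rw [sum_lowers_comp] at h2
        simpa [alternation_comp_swap _ hne' hab] using h2
      · have e : (univ.filter fun x => mu.row x = 1 ∧ (s ∘ Equiv.swap a b) x = o) =
            (univ.filter fun x => mu.row x = 1 ∧ s x = o).erase b := by
          ext x
          simp only [mem_filter_univ, mem_erase, Function.comp_apply]
          by_cases hxb : x = b
          · subst hxb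
            simp [hsa]
          · by_cases hxa : x = a
            · subst hxa
              simp [ha]
            · rw [Equiv.swap_apply_of_ne_of_ne hxa hxb]
              simp [hxb]
        rw [e, card_erase_of_mem (by simpa using hb), hN]
        rfl
      · refine hs.trans_eq ?_
        exact (Finset.card_equiv (Equiv.swap a b) (by simp)).symm

/-- For `i ≠ o` every translate of `rowWordFun` satisfies the equation by itself; the signs matter
only for `i = o`. -/
theorem alternation_mem_kernelIntersection (ho : (o : ℕ) = 0) (h1 : mu.part 1 ≤ lam.part o)
    (hR₀ : ∀ j : Fin m, (o : ℕ) + 1 = j → ∀ t, 1 ≤ t → t ≤ lam.part j →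
      t ≤ mu.part 0 - lam.part o → ((lam.part o - mu.part 1 + t).choose t : K) = 0)
    (hR : ∀ i j : Fin m, i ≠ o → (i : ℕ) + 1 = j → ∀ t, 1 ≤ t → t ≤ lam.part j →
      ((lam.part i + t).choose t : K) = 0) :
    alternation mu.col (rowWordFun K lam mu o) ∈ kernelIntersection K lam := by
  refine ⟨fun w hw => alternation_ne_zero hw, fun i j s hij hs => ?_⟩
  by_cases hi : i = o
  · subst hi
    exact sum_lowers_alternation hij h1 (hR₀ j hij) _ s rfl hs
  · have hj : j ≠ o := by
      rintro rfl
      omega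
    simp only [alternation]
    rw [Finset.sum_comm]
    refine Finset.sum_eq_zero fun σ _ => ?_
    rw [← smul_sum, ← sum_lowers_comp σ (rowWordFun K lam mu o),
      sum_lowers_rowWordFun hij hi hj (hR i j hi hij), smul_zero]
    refine hs.trans_eq ?_
    exact (Finset.card_equiv σ (by simp)).symm

end Alternation

/-! ## The antisymmetrizer of a labelling -/

section Antisymmetrizer

variable (K : Type*) [Field K] (n : ℕ) {r : ℕ} {κ : Type*}

/-- The basis of tensor space indexed by words. -/
noncomputable def tensorBasis (r : ℕ) : Module.Basis (Fin r → Fin n) K (Tensors K n r) :=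
  (Basis.piTensorProduct (fun _ : Fin r => Pi.basisFun K (Fin n))).map (tensorsEquiv K n r)

theorem tensorBasis_apply (w : Fin r → Fin n) :
    tensorBasis K n r w = tmul K n r (fun i => Pi.single (w i) (1 : K)) := by
  simp [tensorBasis, Basis.piTensorProduct_apply, tmul]

theorem permuteK_tensorBasis (σ : Equiv.Perm (Fin r)) (w : Fin r → Fin n) :
    permuteK K n σ (tensorBasis K n r w) = tensorBasis K n r (w ∘ σ) := by
  simp only [tensorBasis_apply, permuteK_tmul]
  rfl

variable {K n}

theorem tensorBasis_repr_permuteK (σ : Equiv.Perm (Fin r)) (x : Tensors K n r) (w : Fin r → Fin n) :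
    (tensorBasis K n r).repr (permuteK K n σ x) (w ∘ σ) = (tensorBasis K n r).repr x w := by
  classical
  have h : (Finsupp.lapply (w ∘ σ) ∘ₗ (tensorBasis K n r).repr.toLinearMap) ∘ₗ permuteK K n σ =
      Finsupp.lapply w ∘ₗ (tensorBasis K n r).repr.toLinearMap := by
    refine (tensorBasis K n r).ext fun v => ?_
    simp only [LinearMap.comp_apply, permuteK_tensorBasis, LinearEquiv.coe_coe,
      Module.Basis.repr_self, Finsupp.lapply_apply, Finsupp.single_apply]
    simp [σ.surjective.injective_comp_right.eq_iff]
  exact LinearMap.congr_fun h x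

theorem permuteK_permuteK (σ τ : Equiv.Perm (Fin r)) (x : Tensors K n r) :
    permuteK K n σ (permuteK K n τ x) = permuteK K n (τ * σ) x :=
  permute_permute K n σ τ x

theorem permuteK_one (x : Tensors K n r) : permuteK K n 1 x = x := by
  have h : permuteK K n (1 : Equiv.Perm (Fin r)) = LinearMap.id := by
    refine tensors_hom_ext fun v => ?_
    simp [permuteK_tmul]
  rw [h, LinearMap.id_apply]

variable (K n) in
/-- The signed sum of the place permutations preserving a labelling. -/
noncomputable def antisymmetrizer (γ : Fin r → κ) : Module.End K (Tensors K n r) :=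
  ∑ σ ∈ labelStab γ, (Equiv.Perm.sign σ : ℤ) • permuteK K n σ

theorem antisymmetrizer_apply (γ : Fin r → κ) (x : Tensors K n r) :
    antisymmetrizer K n γ x = ∑ σ ∈ labelStab γ, (Equiv.Perm.sign σ : ℤ) • permuteK K n σ x := by
  simp [antisymmetrizer, LinearMap.sum_apply]

theorem antisymmetrizer_eq_zero_of_mem {γ : Fin r → κ} {x : Tensors K n r}
    (hx : x ∈ exteriorRel K n γ) : antisymmetrizer K n γ x = 0 := by
  have h : Submodule.span K (repeated K n γ) ≤ LinearMap.ker (antisymmetrizer K n γ) := by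
    rw [Submodule.span_le]
    rintro _ ⟨v, a, b, hab, hγ, hv, rfl⟩
    rw [SetLike.mem_coe, LinearMap.mem_ker, antisymmetrizer_apply]
    refine sum_sign_eq_zero' hab hγ fun σ _ => ?_
    simp only [permuteK_tmul]
    congr 1
    funext i
    exact mem_labelStab.1 (swap_mem_labelStab (γ := v) hv) (σ i)
  exact h hx

/-- Modulo the relations place permutations act by their sign. A transposition `s` is split off to
shrink the support of `σ`; the tensor `x + s x` is fixed by `s`, hence a relation. -/
theorem sub_sign_smul_permuteK_mem {γ : Fin r → κ} (N : ℕ) :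
    ∀ σ ∈ labelStab γ, #σ.support = N → ∀ x : Tensors K n r,
      x - (Equiv.Perm.sign σ : ℤ) • permuteK K n σ x ∈ Submodule.span K (repeated K n γ) := by
  induction N using Nat.strong_induction_on with
  | _ N ih =>
    intro σ hσ hN x
    by_cases h1 : σ = 1
    · subst h1
      simp [permuteK_one]
    obtain ⟨a, ha⟩ : ∃ a, σ a ≠ a := by
      by_contra! hc
      exact h1 (Equiv.ext hc)
    have hγ : γ a = γ (σ a) := (mem_labelStab.1 hσ a).symm
    set s := Equiv.swap a (σ a) with hs
    have hmem : s * σ ∈ labelStab γ := mul_mem_labelStab (swap_mem_labelStab hγ) hσ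
    have h2 := ih _ (hN ▸ Equiv.Perm.card_support_swap_mul ha) (s * σ) hmem rfl
      (permuteK K n s x)
    have h3 : x + permuteK K n s x ∈ Submodule.span K (repeated K n γ) := by
      refine mem_span_repeated_of_swap ha.symm hγ ?_
      rw [map_add, ← hs, permuteK_permuteK, Equiv.swap_mul_self, permuteK_one, add_comm]
    have h4 := Submodule.sub_mem _ h3 h2
    rw [permuteK_permuteK, ← mul_assoc, Equiv.swap_mul_self, one_mul, Equiv.Perm.sign_mul,
      Equiv.Perm.sign_swap ha.symm] at h4
    convert h4 using 1
    simp only [neg_mul, one_mul, Units.val_neg, neg_smul]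
    abel

/-- The order of the stabilizer may vanish in `K`, so averaging is impossible; instead relations are
subtracted from `x` until no basis word is left. -/
theorem mem_exteriorRel_of_antisymmetrizer_eq_zero {γ : Fin r → κ} (N : ℕ) :
    ∀ x : Tensors K n r, #((tensorBasis K n r).repr x).support = N →
      antisymmetrizer K n γ x = 0 → x ∈ exteriorRel K n γ := by
  classical
  induction N using Nat.strong_induction_on with
  | _ N ih =>
    intro x hN hx
    by_cases h0 : x = 0
    · rw [h0]
      exact Submodule.zero_mem _
    set B := tensorBasis K n r with hB
    obtain ⟨w, hw⟩ : (B.repr x).support.Nonempty := by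
      rw [Finsupp.support_nonempty_iff]
      simpa using h0
    -- it suffices to remove `w` from the support
    have step : ∀ y ∈ exteriorRel K n γ, B.repr y w = B.repr x w →
        (B.repr y).support ⊆ (B.repr x).support → x ∈ exteriorRel K n γ := by
      intro y hy hyw hsup
      have hlt : #(B.repr (x - y)).support < N := by
        rw [← hN]
        refine Finset.card_lt_card (Finset.ssubset_iff_of_subset ?_ |>.2 ⟨w, hw, ?_⟩)
        · rw [map_sub]
          exact Finsupp.support_sub.trans (Finset.union_subset subset_rfl hsup)
        · simp [hyw]
      have := ih _ hlt (x - y) rfl (by rw [map_sub, hx, antisymmetrizer_eq_zero_of_mem hy, sub_zero])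
      simpa using Submodule.add_mem _ this hy
    by_cases hrep : ∃ a b, a ≠ b ∧ γ a = γ b ∧ w a = w b
    · obtain ⟨a, b, hab, hγ, hwab⟩ := hrep
      refine step (B.repr x w • B w) ?_ ?_ ?_
      · refine Submodule.smul_mem (Submodule.span K (repeated K n γ)) _ (Submodule.subset_span ?_)
        rw [hB, tensorBasis_apply]
        exact ⟨_, a, b, hab, hγ, by simp [hwab], rfl⟩
      · simp
      · intro v hv
        simp only [map_smul, Module.Basis.repr_self, Finsupp.mem_support_iff, Finsupp.smul_apply,
          Finsupp.single_apply] at hv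
        split_ifs at hv with h
        · exact h ▸ hw
        · simp at hv
    · push Not at hrep
      have hinj : ∀ σ ∈ labelStab γ, w ∘ σ = w → σ = 1 := by
        intro σ hσ h
        ext a : 1
        by_contra hc
        exact hrep (σ a) a hc (mem_labelStab.1 hσ a) (congrFun h a)
      -- The coefficient of `w` in the antisymmetrized tensor. Its term at `1` is nonzero, so
      -- another translate of `w` must occur in `x`.
      have hsum : ∑ σ ∈ labelStab γ,
          (Equiv.Perm.sign σ : ℤ) • B.repr x (w ∘ (σ⁻¹ : Equiv.Perm (Fin r))) = 0 := by
        have h1 : B.repr (antisymmetrizer K n γ x) w = 0 := by simp [hx]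
        rw [antisymmetrizer_apply, map_sum, Finsupp.finsetSum_apply] at h1
        rw [← h1]
        refine Finset.sum_congr rfl fun σ _ => ?_
        rw [map_zsmul, Finsupp.smul_apply, ← tensorBasis_repr_permuteK σ x]
        congr 2
        funext a
        simp
      obtain ⟨σ, hσ, hσ1, hne⟩ : ∃ σ ∈ labelStab γ, σ ≠ 1 ∧ B.repr x (w ∘ σ) ≠ 0 := by
        by_contra! hc
        rw [Finset.sum_eq_single 1] at hsum
        · rw [Finsupp.mem_support_iff] at hw
          exact hw (by simpa using hsum)
        · intro σ hσ h1
          rw [hc _ (inv_mem_labelStab hσ) (by simpa using h1), smul_zero]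
        · intro h
          exact absurd (one_mem_labelStab _) h
      have hww : w ∘ σ ≠ w := fun h => hσ1 (hinj σ hσ h)
      -- This relation removes `w` and otherwise touches only `w ∘ σ`, which already lies in the
      -- support.
      refine step (B.repr x w • (B w - (Equiv.Perm.sign σ : ℤ) • B (w ∘ σ))) ?_ ?_ ?_
      · refine Submodule.smul_mem (Submodule.span K (repeated K n γ)) _ ?_
        rw [hB, ← permuteK_tensorBasis]
        exact sub_sign_smul_permuteK_mem _ σ hσ rfl _
      · simp [hww]
      · intro v hv
        by_contra hc
        rw [Finsupp.mem_support_iff] at hv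
        apply hv
        have h1 : w ≠ v := by
          rintro rfl
          exact hc hw
        have h2 : w ∘ σ ≠ v := by
          rintro rfl
          exact hc (by simpa using hne)
        simp [h1, h2]

end Antisymmetrizer

/-! ## Words acting on `D(λ)` -/

section WordSum

variable {K : Type*} [Field K] {n m r : ℕ} {lam : Parts m r}

/-- The combination with coefficients `h w` of the copies of `x ∈ D(λ)` placed according to the
words `w`. -/
noncomputable def wordSum (x : D K n lam) : ((Fin r → Fin m) → K) →ₗ[K] Tensors K n r :=
  Fintype.linearCombination K fun w => (place K n lam.row w x : Tensors K n r)

theorem wordSum_apply (x : D K n lam) (h : (Fin r → Fin m) → K) :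
    wordSum x h = ∑ w, h w • (place K n lam.row w x : Tensors K n r) :=
  Fintype.linearCombination_apply ..

theorem permuteK_place (x : D K n lam) (w : Fin r → Fin m) (σ : Equiv.Perm (Fin r)) :
    permuteK K n σ (place K n lam.row w x : Tensors K n r) = place K n lam.row (w ∘ σ) x := by
  by_cases h : IsRearrangement lam.row w
  · obtain ⟨β, hβ⟩ := h
    rw [place_eq β hβ, place_eq (β * σ) (by rw [← hβ]; rfl)]
    exact permute_permute K n σ β _
  · have h' : ¬ IsRearrangement lam.row (w ∘ σ) := by
      rintro ⟨β, hβ⟩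
      refine h ⟨β * σ⁻¹, ?_⟩
      funext a
      have := congrFun hβ (σ⁻¹ a)
      simpa using this
    simp [place, h, h']

theorem antisymmetrizer_wordSum {κ : Type*} (γ : Fin r → κ) (x : D K n lam)
    (h : (Fin r → Fin m) → K) :
    antisymmetrizer K n γ (wordSum x h) = wordSum x (alternation γ h) := by
  have e1 : antisymmetrizer K n γ (wordSum x h) = ∑ σ ∈ labelStab γ,
      (Equiv.Perm.sign σ : ℤ) • ∑ w, h w • (place K n lam.row (w ∘ σ) x : Tensors K n r) := by
    rw [antisymmetrizer_apply, wordSum_apply]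
    simp [permuteK_place]
  have e2 : wordSum x (alternation γ h) = ∑ σ ∈ labelStab γ,
      (Equiv.Perm.sign σ : ℤ) • ∑ w, h (w ∘ σ) • (place K n lam.row w x : Tensors K n r) := by
    simp only [wordSum_apply, alternation, Finset.sum_smul, smul_sum]
    rw [Finset.sum_comm]
    exact Finset.sum_congr rfl fun σ _ => Finset.sum_congr rfl fun w _ => smul_assoc ..
  rw [e1, e2]
  -- Moving a permutation from the words to the coefficients inverts it and keeps its sign.
  refine Finset.sum_bij' (fun σ _ => σ⁻¹) (fun σ _ => σ⁻¹) (fun σ hσ => inv_mem_labelStab hσ)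
    (fun σ hσ => inv_mem_labelStab hσ) (by simp) (by simp) fun σ _ => ?_
  rw [Equiv.Perm.sign_inv]
  congr 1
  refine Finset.sum_bij' (fun w _ => w ∘ σ) (fun w _ => w ∘ (σ⁻¹ : Equiv.Perm (Fin r))) (by simp)
    (by simp) ?_ ?_ ?_
  · intro w _
    funext a
    simp
  · intro w _
    funext a
    simp
  · intro w _
    congr 2
    funext a
    simp

theorem wordSum_polytabloid (x : D K n lam) (β : Equiv.Perm (Fin r)) :
    wordSum x (polytabloid K lam β) =
      permuteK K n β (antisymmetrizer K n lam.col (x : Tensors K n r)) := by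
  classical
  rw [polytabloid, map_sum, antisymmetrizer_apply, map_sum]
  refine Finset.sum_congr rfl fun σ _ => ?_
  rw [map_zsmul, map_zsmul]
  congr 1
  have h1 : wordSum x (Pi.single (lam.row ∘ σ ∘ β) (1 : K)) =
      (place K n lam.row (lam.row ∘ σ ∘ β) x : Tensors K n r) := by
    rw [wordSum, Fintype.linearCombination_apply_single, one_smul]
  rw [h1, place_eq (t := lam.row ∘ σ ∘ β) (σ * β) rfl]
  exact (permute_permute K n β σ _).symm

theorem wordSum_eq_zero {x : D K n lam} (hx : (x : Tensors K n r) ∈ exteriorRel K n lam.col)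
    {h : (Fin r → Fin m) → K} (hh : h ∈ kernelIntersection K lam) : wordSum x h = 0 := by
  have h1 : Submodule.span K (Set.range (polytabloid K lam)) ≤ LinearMap.ker (wordSum x) := by
    rw [Submodule.span_le]
    rintro _ ⟨β, rfl⟩
    rw [SetLike.mem_coe, LinearMap.mem_ker, wordSum_polytabloid,
      antisymmetrizer_eq_zero_of_mem hx, map_zero]
  exact h1 (kernelIntersection_le_span K lam hh)

theorem wordSum_mem_exteriorRel {κ : Type*} {γ : Fin r → κ} {x : D K n lam}
    (hx : (x : Tensors K n r) ∈ exteriorRel K n lam.col)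
    {h : (Fin r → Fin m) → K} (hh : alternation γ h ∈ kernelIntersection K lam) :
    wordSum x h ∈ exteriorRel K n γ :=
  mem_exteriorRel_of_antisymmetrizer_eq_zero _ _ rfl
    (by rw [antisymmetrizer_wordSum, wordSum_eq_zero hx hh])

/-- The tensor in which the basis vector `e_i` occupies the positions of row `i`. -/
noncomputable def rowTensor (K : Type*) [Field K] {n : ℕ} (lam : Parts m r) (ι : Fin m → Fin n) :
    D K n lam :=
  ⟨tensorBasis K n r (ι ∘ lam.row), by
    rw [mem_DivPow]
    intro σ hσ
    exact (permuteK_tensorBasis K n σ _).trans (by rw [Function.comp_assoc, hσ])⟩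

theorem place_rowTensor {ι : Fin m → Fin n} {w : Fin r → Fin m} (hw : HasWeight lam w) :
    (place K n lam.row w (rowTensor K lam ι) : Tensors K n r) = tensorBasis K n r (ι ∘ w) := by
  obtain ⟨β, hβ⟩ := hw.isRearrangement
  rw [place_eq β hβ, ← hβ]
  exact permuteK_tensorBasis K n β _

theorem wordSum_rowTensor_ne_zero {ι : Fin m → Fin n} (hι : Function.Injective ι)
    {h : (Fin r → Fin m) → K} (hh : ∀ w, h w ≠ 0 → HasWeight lam w) {w₀ : Fin r → Fin m}
    (hw₀ : h w₀ ≠ 0) : wordSum (rowTensor K lam ι) h ≠ 0 := by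
  classical
  have h1 : wordSum (rowTensor K lam ι) h = ∑ w, h w • tensorBasis K n r (ι ∘ w) := by
    rw [wordSum_apply]
    refine Finset.sum_congr rfl fun w _ => ?_
    by_cases hw : h w = 0
    · simp [hw]
    · rw [place_rowTensor (hh w hw)]
  have h2 : (tensorBasis K n r).repr (wordSum (rowTensor K lam ι) h) (ι ∘ w₀) = h w₀ := by
    rw [h1]
    simp [Finsupp.single_apply, hι.comp_left.eq_iff]
  intro hc
  rw [hc] at h2
  exact hw₀ (by simpa using h2.symm)

end WordSum

/-! ## The sum over the standard tableaux -/

section StandardSum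

variable {m r : ℕ} {lam : Parts m r} {mu : Parts 2 r} {o : Fin m}

theorem mem_ST {T : Fin r → Fin m} : T ∈ ST lam mu ↔ HasWeight lam T ∧
    (∀ b c, mu.row b = mu.row c → mu.col b ≤ mu.col c → T b ≤ T c) ∧
    (∀ b c, mu.col b = mu.col c → mu.row b < mu.row c → T b < T c) := by
  classical
  rw [ST, mem_filter_univ, HasWeight]

theorem rowLex_monotone_iff {T : Fin r → Fin m} :
    Monotone (fun b => toLex (mu.row b, T b)) ↔
      ∀ b c, mu.row b = mu.row c → mu.col b ≤ mu.col c → T b ≤ T c := by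
  constructor
  · intro h b c hbc hcol
    have := h ((mu.col_le_iff hbc).1 hcol)
    rw [Prod.Lex.toLex_le_toLex] at this
    simpa [hbc] using this
  · intro h b c hbc
    rw [Prod.Lex.toLex_le_toLex]
    rcases (mu.row_monotone hbc).lt_or_eq with hlt | heq
    · exact Or.inl hlt
    · exact Or.inr ⟨heq, h b c heq ((mu.col_le_iff heq).2 hbc)⟩

/-- A tableau with increasing rows is the sorted list of its pairs (row, entry), and row-preserving
rearrangements do not change the multiset of these pairs. -/
theorem eq_of_mem_ST_of_comp_eq {T T' : Fin r → Fin m} (hT : T ∈ ST lam mu) (hT' : T' ∈ ST lam mu)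
    {β β' : Equiv.Perm (Fin r)} (hβ : mu.row ∘ β = mu.row) (hβ' : mu.row ∘ β' = mu.row)
    (h : T ∘ β = T' ∘ β') : T = T' := by
  have h1 := rowLex_monotone_iff.2 (mem_ST.1 hT).2.1
  have h2 := rowLex_monotone_iff.2 (mem_ST.1 hT').2.1
  have e : (fun b => toLex (mu.row b, T' b)) =
      (fun b => toLex (mu.row b, T b)) ∘ (β * β'⁻¹ : Equiv.Perm (Fin r)) := by
    funext b
    have h3 := congrFun h (β'⁻¹ b)
    have h4 := congrFun hβ (β'⁻¹ b)
    have h5 := congrFun hβ' (β'⁻¹ b)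
    have e0 : β' (β'⁻¹ b) = b := by simp
    simp only [Function.comp_apply, e0] at h3 h4 h5
    simp only [Function.comp_apply, Equiv.Perm.mul_apply, h3, h4, ← h5]
  rw [e] at h2
  have h3 := Tuple.unique_monotone (σ := 1) h1 h2
  rw [← e] at h3
  funext b
  have := congrFun h3 b
  simpa using this

/-- Sorting each row suffices: all `λ_o ≥ μ_2` letters `o` then open the first row and fill the tops
of the two-box columns, so the columns increase strictly automatically. -/
theorem exists_mem_ST (ho : (o : ℕ) = 0) (h1 : mu.part 1 ≤ lam.part o) {w : Fin r → Fin m}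
    (hw : IsRowWord lam mu o w) :
    ∃ T ∈ ST lam mu, ∃ β : Equiv.Perm (Fin r), mu.row ∘ β = mu.row ∧ T ∘ β = w := by
  classical
  have hmin : ∀ k : Fin m, k ≠ o → o < k := by
    intro k hk
    rw [Fin.lt_def, ho]
    have : (k : ℕ) ≠ o := fun h => hk (Fin.ext h)
    omega
  set W : Fin r → Fin 2 ×ₗ Fin m := fun b => toLex (mu.row b, w b) with hW
  set σ := Tuple.sort W with hσ
  have hmono : Monotone (W ∘ σ) := Tuple.monotone_sort W
  have hrow : mu.row ∘ σ = mu.row := by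
    refine Tuple.unique_monotone (τ := 1) (fun b c hbc => ?_) (by simpa using mu.row_monotone)
    have := hmono hbc
    simp only [hW, Function.comp_apply] at this
    rw [Prod.Lex.toLex_le_toLex] at this
    rcases this with h | h
    · exact h.le
    · exact h.1.le
  have hrows : ∀ b c, mu.row b = mu.row c → mu.col b ≤ mu.col c → (w ∘ σ) b ≤ (w ∘ σ) c := by
    rw [← rowLex_monotone_iff]
    convert hmono using 1
    funext b
    simp only [hW, Function.comp_apply]
    rw [← congrFun hrow b]
    rfl
  have hbot : ∀ b, mu.row b = 1 → (w ∘ σ) b ≠ o := by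
    intro b hb
    exact hw.2 (σ b) ((congrFun hrow b).trans hb)
  have htop : ∀ a, mu.row a = 0 → mu.col a < mu.part 1 → (w ∘ σ) a = o := by
    intro a ha hcol
    by_contra hne
    have h2 := hw.1.comp σ o
    -- If the entry at `a` is not `o`, every `o` lies to its left in the first row, leaving fewer
    -- than `μ_2` places.
    have h3 : #{x | (w ∘ σ) x = o} ≤ #(Finset.range (mu.col a)) := by
      have key : ∀ x, (w ∘ σ) x = o → mu.row x = 0 := by
        intro x hx
        have : mu.row x ≠ 1 := fun h => hbot x h hx
        omega
      refine Finset.card_le_card_of_injOn mu.col ?_ ?_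
      · intro x hx
        have hx' : (w ∘ σ) x = o := by simpa using hx
        simp only [coe_range, Set.mem_Iio]
        by_contra! hle
        have h4 := hrows a x (ha.trans (key x hx').symm) hle
        rw [hx'] at h4
        exact absurd (hmin _ hne) (not_lt.2 h4)
      · intro x hx y hy hxy
        have hx' : (w ∘ σ) x = o := by simpa using hx
        have hy' : (w ∘ σ) y = o := by simpa using hy
        exact mu.box_ext ((key x hx').trans (key y hy').symm) hxy
    rw [card_range] at h3
    omega
  refine ⟨w ∘ σ, mem_ST.2 ⟨hw.1.comp σ, hrows, fun b c hcol hlt => ?_⟩, σ⁻¹, ?_, ?_⟩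
  · have hc : mu.row c = 1 := by omega
    have hb : mu.row b = 0 := by omega
    rw [htop b hb (by rw [hcol, ← hc]; exact mu.col_lt c)]
    exact hmin _ (hbot c hc)
  · funext b
    simpa using (congrFun hrow (σ⁻¹ b)).symm
  · funext b
    simp

theorem ne_of_mem_ST {T : Fin r → Fin m} (hT : T ∈ ST lam mu) (ho : (o : ℕ) = 0) {b : Fin r}
    (hb : mu.row b = 1) : T b ≠ o := by
  obtain ⟨a, ha, hab, -⟩ := mu.exists_partner hb
  have := (mem_ST.1 hT).2.2 a b hab (by rw [ha, hb]; exact Fin.zero_lt_one)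
  rintro rfl
  rw [Fin.lt_def] at this
  omega

-- Each row word arises exactly once: its sorted rows determine the tableau, and the word itself
-- together with the row labels is the shuffle.
open Classical in
theorem sum_ST_shuffles {M : Type*} [AddCommMonoid M] (ho : (o : ℕ) = 0)
    (h1 : mu.part 1 ≤ lam.part o) (P : (Fin r → Fin m) → M) :
    ∑ T ∈ ST lam mu, ∑ t ∈ shuffles (Prod.snd : Fin m × Fin 2 → Fin 2) (fun b => (T b, mu.row b)),
      P (Prod.fst ∘ t) = ∑ w with IsRowWord lam mu o w, P w := by
  have hsh : ∀ (T : Fin r → Fin m) (t : Fin r → Fin m × Fin 2),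
      t ∈ shuffles (Prod.snd : Fin m × Fin 2 → Fin 2) (fun b => (T b, mu.row b)) ↔
      (∃ β : Equiv.Perm (Fin r), mu.row ∘ β = mu.row ∧ T ∘ β = Prod.fst ∘ t) ∧
        Prod.snd ∘ t = mu.row := by
    intro T t
    rw [mem_shuffles]
    constructor
    · rintro ⟨⟨β, rfl⟩, h⟩
      exact ⟨⟨β, h, rfl⟩, h⟩
    · rintro ⟨⟨β, h2, h3⟩, h⟩
      refine ⟨⟨β, ?_⟩, h⟩
      funext b
      exact Prod.ext (congrFun h3 b) ((congrFun h2 b).trans (congrFun h b).symm)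
  rw [Finset.sum_sigma']
  refine Finset.sum_bij (fun x _ => Prod.fst ∘ x.2) ?_ ?_ ?_ ?_
  · rintro ⟨T, t⟩ hx
    rw [mem_sigma, hsh] at hx
    obtain ⟨hT, ⟨β, hβ, hβT⟩, -⟩ := hx
    rw [mem_filter_univ]
    simp only at hβT ⊢
    rw [← hβT]
    exact ⟨(mem_ST.1 hT).1.comp β, fun b hb => ne_of_mem_ST hT ho ((congrFun hβ b).trans hb)⟩
  · rintro ⟨T, t⟩ hx ⟨T', t'⟩ hx' heq
    rw [mem_sigma, hsh] at hx hx'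
    obtain ⟨hT, ⟨β, hβ, hβT⟩, h⟩ := hx
    obtain ⟨hT', ⟨β', hβ', hβT'⟩, h'⟩ := hx'
    simp only at heq hT hT' hβT hβT' h h'
    have e1 : T = T' := eq_of_mem_ST_of_comp_eq hT hT' hβ hβ' (by rw [hβT, hβT', heq])
    have e2 : t = t' := by
      funext b
      exact Prod.ext (congrFun heq b) ((congrFun h b).trans (congrFun h' b).symm)
    rw [e1, e2]
  · intro w hw
    rw [mem_filter_univ] at hw
    obtain ⟨T, hT, β, hβ, hβT⟩ := exists_mem_ST ho h1 hw
    refine ⟨⟨T, fun b => (w b, mu.row b)⟩, ?_, rfl⟩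
    rw [mem_sigma, hsh]
    exact ⟨hT, ⟨β, hβ, hβT⟩, rfl⟩
  · intro x _
    rfl

variable {K : Type*} [Field K] {n : ℕ}

theorem coe_mul {ι κ : Type*} [Fintype ι] (f : ι → κ) (ρ' : Fin r → ι) (y : DivPow K n ρ') :
    (mul K n f ρ' y : Tensors K n r) = ∑ t ∈ shuffles f ρ', (place K n ρ' t y : Tensors K n r) := by
  simp [mul, LinearMap.sum_apply]

theorem coe_comul {ι κ : Type*} (f : ι → κ) (ρ' : Fin r → ι) (y : DivPow K n (f ∘ ρ')) :
    (comul K n f ρ' y : Tensors K n r) = y := by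
  rw [comul, Submodule.coe_inclusion]

theorem coe_phi_apply (T : Fin r → Fin m) (x : D K n lam) :
    (phi K n lam mu T x : Ext K n mu.col) = (exteriorRel K n mu.col).mkQ
      (∑ t ∈ shuffles (Prod.snd : Fin m × Fin 2 → Fin 2) (fun b => (T b, mu.row b)),
        (place K n lam.row (Prod.fst ∘ t) x : Tensors K n r)) := by
  set ρ' : Fin r → Fin m × Fin 2 := fun b => (T b, mu.row b) with hρ'
  set y : DivPow K n ρ' := comul K n Prod.fst ρ' (place K n lam.row T x) with hy
  have hyx : (y : Tensors K n r) = place K n lam.row T x := coe_comul _ _ _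
  have h1 : (phi K n lam mu T x : Ext K n mu.col) = (exteriorRel K n mu.col).mkQ
      (Subtype.val (mul K n (Prod.snd : Fin m × Fin 2 → Fin 2) ρ' y)) := rfl
  rw [h1, coe_mul]
  congr 1
  refine Finset.sum_congr rfl fun t ht => ?_
  obtain ⟨⟨β, hβ⟩, -⟩ := mem_shuffles.1 ht
  have e : Prod.fst ∘ t = T ∘ β := by
    rw [← hβ]
    rfl
  rw [place_eq β hβ, hyx, e, ← permuteK_place x T β]
  rfl

theorem coe_sum_phi_apply (ho : (o : ℕ) = 0) (h1 : mu.part 1 ≤ lam.part o) (x : D K n lam) :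
    ((∑ T ∈ ST lam mu, phi K n lam mu T) x : Ext K n mu.col) =
      (exteriorRel K n mu.col).mkQ (wordSum x (rowWordFun K lam mu o)) := by
  classical
  have h2 : ((∑ T ∈ ST lam mu, phi K n lam mu T) x : Ext K n mu.col) =
      ∑ T ∈ ST lam mu, (phi K n lam mu T x : Ext K n mu.col) := by
    rw [LinearMap.sum_apply, Submodule.coe_sum]
  rw [h2, Finset.sum_congr rfl fun T _ => coe_phi_apply T x, ← map_sum, sum_ST_shuffles ho h1
    (fun w => (place K n lam.row w x : Tensors K n r)), wordSum_apply, Finset.sum_filter]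
  congr 1
  refine Finset.sum_congr rfl fun w _ => ?_
  rw [rowWordFun]
  split_ifs <;> simp

end StandardSum

/-! ### Binomial vanishing and a nonzero coefficient -/

theorem choose_eq_zero_of_dvd_R (K : Type*) [Field K] (p : ℕ) [CharP K p] {x y t : ℕ}
    (h : p ∣ R (x + 1) y) (ht : 1 ≤ t) (hty : t ≤ y) : ((x + t).choose t : K) = 0 := by
  have h1 : R (x + 1) y ∣ (x + 1 + t - 1).choose t :=
    Finset.gcd_dvd (f := fun j => (x + 1 + j - 1).choose j) (Finset.mem_Icc.2 ⟨ht, hty⟩)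
  rw [CharP.cast_eq_zero_iff K p]
  have e : x + 1 + t - 1 = x + t := by omega
  rw [e] at h1
  exact h.trans h1

theorem Parts.le_of_pos {m r : ℕ} (lam : Parts m r) (hpos : ∀ i, 0 < lam.part i) : m ≤ r := by
  rw [← lam.sum_eq]
  simpa using Finset.card_nsmul_le_sum univ lam.part 1 fun i _ => hpos i

theorem Parts.row_eq_of_val_lt {m r : ℕ} (lam : Parts m r) {o : Fin m}
    (ho : (o : ℕ) = 0) {b : Fin r} (hb : (b : ℕ) < lam.part o) : lam.row b = o := by
  by_contra hne
  have h1 := lam.box_val b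
  have h2 : lam.part o ≤ ∑ j with j < lam.row b, lam.part j := by
    refine Finset.single_le_sum (f := lam.part) (fun _ _ => Nat.zero_le _) ?_
    rw [mem_filter_univ, Fin.lt_def, ho]
    have : (lam.row b : ℕ) ≠ o := fun h => hne (Fin.ext h)
    omega
  omega

theorem Parts.row_ne_of_le {m r : ℕ} (lam : Parts m r) {o : Fin m}
    (ho : (o : ℕ) = 0) {b : Fin r} (hb : lam.part o ≤ b) : lam.row b ≠ o := by
  intro h
  have h1 := lam.box_val b
  have h2 := lam.col_lt b
  rw [h] at h1 h2
  rw [Finset.filter_eq_empty_iff.2] at h1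
  · simp at h1
    omega
  · intro j _
    rw [Fin.lt_def, ho]
    omega

/-- In `lam.row` the letter `o` fills the first `λ_o` boxes of μ, numbered row by row. As `μ_2 ≤ λ_o
≤ μ_1`, these stay in the first row and cover the tops of all two-box columns. -/
theorem alternation_row_eq_one {m r : ℕ} (K : Type*) [Field K] {lam : Parts m r} {mu : Parts 2 r}
    {o : Fin m} (ho : (o : ℕ) = 0) (h1 : mu.part 1 ≤ lam.part o) (h2 : lam.part o ≤ mu.part 0) :
    alternation mu.col (rowWordFun K lam mu o) lam.row = 1 := by
  refine alternation_eq_one ⟨hasWeight_row lam, fun b hb => ?_⟩ fun a ha hcol => ?_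
  · refine lam.row_ne_of_le ho (h2.trans ?_)
    by_contra! hlt
    have := mu.row_eq_of_val_lt (o := 0) rfl hlt
    rw [hb] at this
    exact absurd this (by simp)
  · refine lam.row_eq_of_val_lt ho ?_
    have h3 := mu.box_val a
    rw [ha] at h3
    simp only [Fin.not_lt_zero, filter_false, sum_empty, zero_add] at h3
    omega

end WeylHom

theorem theorem3p1 (K : Type*) [Field K] [Infinite K] (p : ℕ) [CharP K p] (hp : 0 < p)
    (n r m : ℕ) (hr : 0 < r) (hn : r ≤ n) (hm : 2 ≤ m)
    (lam : WeylHom.Parts m r) (mu : WeylHom.Parts 2 r)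
    (hpos : ∀ i, 0 < lam.part i)
    (h1 : mu.part 1 ≤ lam.part ⟨0, by omega⟩) (h2 : lam.part ⟨0, by omega⟩ ≤ mu.part 0)
    (hR1 : p ∣ WeylHom.R (lam.part ⟨0, by omega⟩ - mu.part 1 + 1)
      (min (lam.part ⟨1, by omega⟩) (mu.part 0 - lam.part ⟨0, by omega⟩)))
    (hR : ∀ (i : ℕ) (hi : i + 1 < m), 1 ≤ i →
      p ∣ WeylHom.R (lam.part ⟨i, by omega⟩ + 1) (lam.part ⟨i + 1, hi⟩)) :
    ∃ ψ : WeylHom.Weyl K n lam →ₗ[WeylHom.SchurAlgebra K n r] WeylHom.Weyl K n mu,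
      ψ.comp (WeylHom.toWeyl K n lam) =
        (∑ T ∈ WeylHom.ST lam mu, WeylHom.phi K n lam mu T) ∧
      ψ ≠ 0 := by
  open WeylHom in
  set o : Fin m := ⟨0, by omega⟩ with ho
  have halt : alternation mu.col (rowWordFun K lam mu o) ∈ kernelIntersection K lam := by
    refine alternation_mem_kernelIntersection rfl h1 ?_ ?_
    · rintro j hj t ht htj htm
      have : j = ⟨1, by omega⟩ := Fin.ext hj.symm
      rw [this] at htj
      exact choose_eq_zero_of_dvd_R K p hR1 ht (le_min htj htm)
    · rintro ⟨i, hi⟩ ⟨j, hj⟩ hio hij t ht htj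
      simp only at hij
      subst hij
      refine choose_eq_zero_of_dvd_R K p (hR i hj ?_) ht htj
      by_contra hc
      exact hio (Fin.ext (by simp [ho]; omega))
  set Φ := ∑ T ∈ ST lam mu, phi K n lam mu T with hΦ
  have hker : LinearMap.ker (toWeyl K n lam) ≤ LinearMap.ker Φ := by
    intro x hx
    rw [LinearMap.mem_ker] at hx ⊢
    have hx' : (x : Tensors K n r) ∈ exteriorRel K n lam.col := by
      rw [← Submodule.Quotient.mk_eq_zero]
      exact congrArg Subtype.val hx
    refine Subtype.ext ((coe_sum_phi_apply rfl h1 x).trans ?_)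
    rw [Submodule.mkQ_apply]
    exact (Submodule.Quotient.mk_eq_zero _).2 (wordSum_mem_exteriorRel hx' halt)
  have hsurj : Function.Surjective (toWeyl K n lam) := LinearMap.surjective_rangeRestrict _
  have hcomp : (((LinearMap.ker (toWeyl K n lam)).liftQ Φ hker).comp
      ((toWeyl K n lam).quotKerEquivOfSurjective hsurj).symm.toLinearMap).comp
        (toWeyl K n lam) = Φ := by
    ext1 x
    have : ((toWeyl K n lam).quotKerEquivOfSurjective hsurj).symm (toWeyl K n lam x) =
        Submodule.Quotient.mk x := by
      rw [LinearEquiv.symm_apply_eq]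
      rfl
    simp [this]
  refine ⟨_, hcomp, fun h0 => ?_⟩
  rw [h0, LinearMap.zero_comp] at hcomp
  have hmn : m ≤ n := (lam.le_of_pos hpos).trans hn
  set x := rowTensor K lam (Fin.castLE hmn) with hx
  have h3 := coe_sum_phi_apply rfl h1 x
  rw [← hΦ, ← hcomp] at h3
  -- If the induced map were zero, this tensor would be a relation, hence killed by the
  -- antisymmetrizer, although the alternation is 1 at `lam.row`.
  have h4 : wordSum x (rowWordFun K lam mu o) ∈ exteriorRel K n mu.col := by
    rw [← Submodule.Quotient.mk_eq_zero]
    exact h3.symm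
  have h5 := antisymmetrizer_eq_zero_of_mem h4
  rw [antisymmetrizer_wordSum] at h5
  refine wordSum_rowTensor_ne_zero (Fin.castLE_injective hmn) (fun w hw => alternation_ne_zero hw)
    (w₀ := lam.row) ?_ h5
  rw [alternation_row_eq_one K rfl h1 h2]
  exact one_ne_zero
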